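/- Let $X\subset\mathbb R^n$ be closed with positive Lebesgue measure, let $p\in C^1(X)$ with $p>0$ on $X$ and $0<Z:=\int_X p(x)\,dx<\infty$, and let $\mu^*$ be the probability measure $\mu^*(B)=Z^{-1}\int_{B\cap X}p(x)\,dx$. Let $(\phi_\epsilon)_{\epsilon>0}\subset C^1(\mathbb R^n)$ be a family of mollifiers, that is: $\phi_\epsilon\ge 0$, $\phi_\epsilon(x)=\phi_\epsilon(-x)$, $\|\phi_\epsilon\|_1=1$, $\sup_x\phi_\epsilon(x)<\infty$ for every $\epsilon>0$, and $\lim_{\epsilon\to0}\|\mathbf 1_{\mathbb R^n\setminus B_\delta(0)}\phi_\epsilon\|_q=0$ for every $\delta>0$ and $q\in\{1,\infty\}$. For $\mu\in\mathcal P(\mathbb R^n)$ (Borel probability measures with weak convergence) let $$\mathcal E_\epsilon(\mu)=\iint W_\epsilon(x,y)\,d\mu(x)\,d\mu(y)\in[0,\infty],$$ where $W_\epsilon(x,y)=\phi_\epsilon(x-y)\,(p(x)p(y))^{-1/2}$ if $x,y\in X$ and $W_\epsilon(x,y)=\infty$ otherwise. Let $\chi^2(\mu\|\mu^*)=\int\left(\frac{d\mu}{d\mu^*}-1\right)^2d\mu^*$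 if $\mu\ll\mu^*$, and $\infty$ otherwise. Suppose that for every $\epsilon>0$ the kernel $k_\epsilon(x,y)=\phi_\epsilon(x-y)$ is integrally strictly positive definite on $X$: for every finite signed Borel measure $\nu$ on $X$ the energy $\iint k_\epsilon\,d(\nu\times\nu)$ is well defined and nonnegative, and it is $0$ only if $\nu=0$. Then, as $\epsilon\to0$, $\mathcal E_\epsilon$ $\Gamma$-converges to $\mathcal E:=\frac1Z\left(\chi^2(\cdot\|\mu^*)+1\right)$ on $\mathcal P(\mathbb R^n)$, that is: (a) whenever $\mu_\epsilon\to\mu$ weakly, $\liminf_{\epsilon\to0}\mathcal E_\epsilon(\mu_\epsilon)\ge\mathcal E(\mu)$; (b) for every $\mu$ there are $\mu_\epsilon\to\mu$ weakly with $\limsup_{\epsilon\to0}\mathcal E_\epsilon(\mu_\epsilon)\le\mathcal E(\mu)$. If moreover $X$ is compact, then for every $\epsilon>0$ the energy $\mathcal E_\epsilon$ has a unique minimizer $\mu^*_\epsilon$ over $\mathcal P(X)$, and, as $\epsilon\to0$, $\mu^*_\epsilon\to\mu^*$ weakly and $\mathcal E_\epsilon(\mu^*_\epsilon)\to\frac1Z$.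 In particular, if $p$ is normalized ($Z=1$), the $\Gamma$-limit is $\chi^2(\cdot\|\mu^*)+1$ and $\mathcal E_\epsilon(\mu^*_\epsilon)\to1$. -/

import Mathlib

open MeasureTheory Filter Topology Set
open scoped ENNReal

noncomputable section

namespace MollifiedEnergy

/-- Euclidean space `ℝⁿ`; its `volume` is Lebesgue measure. -/
abbrev E (n : ℕ) : Type := EuclideanSpace ℝ (Fin n)

/-! ### Mollifiers -/

/-- A family `(φ_ε)_{ε > 0}` of mollifiers on `ℝⁿ`.  Only the values for `ε > 0` matter. -/
structure IsMollifierFamily {n : ℕ} (φ : ℝ → E n → ℝ) : Prop where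
  contDiff : ∀ ε > 0, ContDiff ℝ 1 (φ ε)
  nonneg : ∀ ε > 0, ∀ x, 0 ≤ φ ε x
  even : ∀ ε > 0, ∀ x, φ ε (-x) = φ ε x
  norm_one : ∀ ε > 0, eLpNorm (φ ε) 1 volume = 1
  bddAbove : ∀ ε > 0, BddAbove (range (φ ε))
  tendsto_one : ∀ δ > 0, Tendsto
    (fun ε => eLpNorm ((Metric.ball (0 : E n) δ)ᶜ.indicator (φ ε)) 1 volume) (𝓝[>] 0) (𝓝 0)
  tendsto_top : ∀ δ > 0, Tendsto
    (fun ε => eLpNorm ((Metric.ball (0 : E n) δ)ᶜ.indicator (φ ε)) ∞ volume) (𝓝[>] 0) (𝓝 0)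

/-! ### Integrally strictly positive definite kernels -/

section Kernel

variable {Y : Type*} [MeasurableSpace Y]

/-- The positive part `ν⁺ × ν⁺ + ν⁻ × ν⁻` of the signed product measure `ν × ν`. -/
def prodPos (ν : SignedMeasure Y) : Measure (Y × Y) :=
  ν.toJordanDecomposition.posPart.prod ν.toJordanDecomposition.posPart +
    ν.toJordanDecomposition.negPart.prod ν.toJordanDecomposition.negPart

/-- The negative part `ν⁺ × ν⁻ + ν⁻ × ν⁺` of the signed product measure `ν × ν`. -/
def prodNeg (ν : SignedMeasure Y) : Measure (Y × Y) :=
  ν.toJordanDecomposition.posPart.prod ν.toJordanDecomposition.negPart +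
    ν.toJordanDecomposition.negPart.prod ν.toJordanDecomposition.posPart

/-- The positive contribution to `∬ K d(ν × ν)`. -/
def energyPos (K : Y → Y → ℝ) (ν : SignedMeasure Y) : ℝ≥0∞ :=
  ∫⁻ z, ENNReal.ofReal (K z.1 z.2) ∂(prodPos ν) + ∫⁻ z, ENNReal.ofReal (-K z.1 z.2) ∂(prodNeg ν)

/-- The negative contribution to `∬ K d(ν × ν)`. -/
def energyNeg (K : Y → Y → ℝ) (ν : SignedMeasure Y) : ℝ≥0∞ :=
  ∫⁻ z, ENNReal.ofReal (K z.1 z.2) ∂(prodNeg ν) + ∫⁻ z, ENNReal.ofReal (-K z.1 z.2) ∂(prodPos ν)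

/-- The energy `∬ K(x, y) d(ν × ν)(x, y)` of a finite signed measure `ν`, meaningful when the two
contributions are not both infinite. -/
def signedEnergy (K : Y → Y → ℝ) (ν : SignedMeasure Y) : EReal :=
  (energyPos K ν : EReal) - (energyNeg K ν : EReal)

/-- `K` is an integrally strictly positive definite (i.s.p.d.) kernel on `Y`: it is symmetric and
lower semicontinuous, and for every finite signed measure `ν` its energy is well defined and
nonnegative, and vanishes only if `ν = 0`. -/
structure IsISPD [TopologicalSpace Y] (K : Y → Y → ℝ) : Prop where
  symm : ∀ x y, K x y = K y x
  lsc : LowerSemicontinuous (fun z : Y × Y => K z.1 z.2)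
  wellDefined : ∀ ν : SignedMeasure Y, energyPos K ν ≠ ∞ ∨ energyNeg K ν ≠ ∞
  nonneg : ∀ ν : SignedMeasure Y, 0 ≤ signedEnergy K ν
  eq_zero : ∀ ν : SignedMeasure Y, signedEnergy K ν = 0 → ν = 0

end Kernel

/-! ### The target measure -/

/-- The total mass `Z = ∫_X p(x) dx` of the (possibly unnormalized) target density. -/
def mass {n : ℕ} (X : Set (E n)) (p : E n → ℝ) : ℝ≥0∞ :=
  ∫⁻ x in X, ENNReal.ofReal (p x)

/-- `p` is an admissible target density on `X`: `p ∈ C¹(X)`, `p > 0` on `X` and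
`0 < ∫_X p < ∞`.  The values of `p` outside `X` are irrelevant. -/
structure IsTargetDensity {n : ℕ} (X : Set (E n)) (p : E n → ℝ) : Prop where
  contDiffOn : ContDiffOn ℝ 1 p X
  pos : ∀ x ∈ X, 0 < p x
  mass_pos : 0 < mass X p
  mass_lt_top : mass X p < ∞

/-- The target probability measure `μ*(B) = ∫_{B ∩ X} p(x) dx / ∫_X p(x) dx`. -/
def target {n : ℕ} {X : Set (E n)} {p : E n → ℝ} (hp : IsTargetDensity X p) :
    ProbabilityMeasure (E n) :=
  ⟨(mass X p)⁻¹ • (volume.restrict X).withDensity (fun x => ENNReal.ofReal (p x)), ⟨by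
    rw [Measure.smul_apply, withDensity_apply _ MeasurableSet.univ, Measure.restrict_univ,
      smul_eq_mul]
    exact ENNReal.inv_mul_cancel hp.mass_pos.ne' hp.mass_lt_top.ne⟩⟩

/-! ### Mollified interaction energy, `χ²`-divergence and `Γ`-convergence -/

open Classical in
/-- The weighted kernel: `φ_ε(x - y) (p(x) p(y))^{-1/2}` if `x, y ∈ X`, and `∞` otherwise. -/
def weightedKernel {n : ℕ} (X : Set (E n)) (p : E n → ℝ) (φ : ℝ → E n → ℝ) (ε : ℝ) (x y : E n) :
    ℝ≥0∞ :=
  if x ∈ X ∧ y ∈ X then ENNReal.ofReal (φ ε (x - y) * (p x * p y) ^ (-(1 / 2) : ℝ)) else ∞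

/-- The mollified interaction energy `𝓔_ε(μ) = ∬ W_ε(x, y) dμ(x) dμ(y)`. -/
def energy {n : ℕ} (X : Set (E n)) (p : E n → ℝ) (φ : ℝ → E n → ℝ) (ε : ℝ)
    (μ : ProbabilityMeasure (E n)) : ℝ≥0∞ :=
  ∫⁻ y, ∫⁻ x, weightedKernel X p φ ε x y ∂(μ : Measure (E n)) ∂(μ : Measure (E n))

open Classical in
/-- The `χ²`-divergence `χ²(Q ‖ P) = ∫ (dQ/dP - 1)² dP` if `Q ≪ P`, and `∞` otherwise. -/
def chiSq {Ω : Type*} [MeasurableSpace Ω] (Q P : ProbabilityMeasure Ω) : ℝ≥0∞ :=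
  if (Q : Measure Ω) ≪ (P : Measure Ω) then
    ∫⁻ x, ENNReal.ofReal ((((Q : Measure Ω).rnDeriv (P : Measure Ω) x).toReal - 1) ^ 2)
      ∂(P : Measure Ω)
  else ∞

/-- `Γ`-convergence, as `ε → 0⁺`, of functionals `F_ε` on the probability measures (with the
topology of weak convergence). -/
structure GammaConverges {n : ℕ} (F : ℝ → ProbabilityMeasure (E n) → ℝ≥0∞)
    (F₀ : ProbabilityMeasure (E n) → ℝ≥0∞) : Prop where
  liminf_ge : ∀ (μ : ℝ → ProbabilityMeasure (E n)) (μ₀ : ProbabilityMeasure (E n)),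
    Tendsto μ (𝓝[>] 0) (𝓝 μ₀) → F₀ μ₀ ≤ liminf (fun ε => F ε (μ ε)) (𝓝[>] 0)
  limsup_le : ∀ μ₀ : ProbabilityMeasure (E n), ∃ μ : ℝ → ProbabilityMeasure (E n),
    Tendsto μ (𝓝[>] 0) (𝓝 μ₀) ∧ limsup (fun ε => F ε (μ ε)) (𝓝[>] 0) ≤ F₀ μ₀

/-- `𝓟(X)`: the probability measures on `ℝⁿ` that are carried by `X`. -/
def probOn {n : ℕ} (X : Set (E n)) : Set (ProbabilityMeasure (E n)) :=
  {μ | (μ : Measure (E n)) X = 1}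

/-- `μ` minimizes `𝓔_ε` over `𝓟(X)`. -/
def IsMinimizer {n : ℕ} (X : Set (E n)) (p : E n → ℝ) (φ : ℝ → E n → ℝ) (ε : ℝ)
    (μ : ProbabilityMeasure (E n)) : Prop :=
  μ ∈ probOn X ∧ ∀ ν ∈ probOn X, energy X p φ ε μ ≤ energy X p φ ε ν

end MollifiedEnergy

end

/-!
The `Γ`-limsup inequality holds with constant families. If `μ = f dx` is carried by `X` and
`g = p ^ (-1/2) f`, then the limit energy of `μ` is `∫ g²` (`chiSq_add_one_div_mass`), while
`𝓔_ε(μ) = ∬ φ_ε(x - y) g(x) g(y) dx dy ≤ ∫ g²`, because `φ_ε` has integral one (`energy_le`).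

The `Γ`-liminf inequality is the main point, because the kernel is positive definite on `X` only,
and `X` may have empty interior: a test measure `h dx` with `h` continuous is then not available.
The way out is an averaging over translations. For a compact `A ⊆ X` of positive volume, translate
two measures by `r`, restrict them to `A`, apply positive definiteness there and integrate over `r`.
This shows that `φ_ε(x - y) · vol((A - x) ∩ (A - y))` is a positive definite kernel on all of `ℝⁿ`
(`IsAdmissible.two_mul_lintegral_overlap_le`). Since `φ_ε ≥ 0`, this kernel is dominated by
`vol(A) φ_ε(x - y)`, and since `r ↦ vol(A ∩ (r + A))` is continuous at `0`, it is still `vol(A)`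
times an approximate identity. Testing it against `ψ μ_ε - h dx`, with `ψ ≤ p ^ (-1/2)` bounded and
continuous and `h ∈ C_c`, and letting `ε → 0` gives `2 ∫ h ψ dμ₀ ≤ L + ∫ h²` whenever
`𝓔_ε(μ_ε) ≤ L` frequently (`two_mul_lintegral_le_of_tendsto`). By density this extends to `h ∈ L²`,
hence `ψ μ₀` has a density whose squared `L²`-norm is at most `L`
(`lintegral_sq_le_of_two_mul_lintegral_le`); now let `ψ` increase to `p ^ (-1/2)`
(`chiSq_le_of_frequently_energy_le`).

For compact `X` the energy is continuous on the compact set `𝓟(X)`, so that minimizers exist, and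
strict positive definiteness makes them unique (`IsMinimizer.unique`). Their energies are at most
`𝓔_ε(μ*) ≤ 1 / Z`, so by the liminf inequality every limit point `μ` has `χ²(μ ‖ μ*) = 0`.
-/

namespace MollifiedEnergy

/-! ### Positive definiteness tested on pairs of positive measures -/

section Pairs

variable {Y : Type*} [MeasurableSpace Y]

/-- The mutual energy `∬ K(x, y) dm₁(x) dm₂(y)` of two positive measures, for a nonnegative kernel
(the negative part of `K` is discarded). -/
noncomputable def mutualEnergy (K : Y → Y → ℝ) (m₁ m₂ : Measure Y) : ℝ≥0∞ :=
  ∫⁻ z, ENNReal.ofReal (K z.1 z.2) ∂(m₁.prod m₂)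

theorem mutualEnergy_ne_top {K : Y → Y → ℝ} {M : ℝ} (hM : ∀ x y, K x y ≤ M)
    (m₁ m₂ : Measure Y) [IsFiniteMeasure m₁] [IsFiniteMeasure m₂] :
    mutualEnergy K m₁ m₂ ≠ ∞ := by
  refine ne_top_of_le_ne_top ?_
    (lintegral_mono (g := fun _ => ENNReal.ofReal M) fun z => ENNReal.ofReal_le_ofReal (hM _ _))
  rw [lintegral_const]
  exact ENNReal.mul_ne_top ENNReal.ofReal_ne_top (measure_ne_top _ _)

theorem mutualEnergy_add_left (K : Y → Y → ℝ) (m₁ m₂ m : Measure Y) [SFinite m₁] [SFinite m₂]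
    [SFinite m] : mutualEnergy K (m₁ + m₂) m = mutualEnergy K m₁ m + mutualEnergy K m₂ m := by
  simp [mutualEnergy, Measure.add_prod]

theorem mutualEnergy_comm {K : Y → Y → ℝ} (hK : Measurable fun z : Y × Y => K z.1 z.2)
    (hs : ∀ x y, K x y = K y x) (m₁ m₂ : Measure Y) [SFinite m₁] [SFinite m₂] :
    mutualEnergy K m₁ m₂ = mutualEnergy K m₂ m₁ := by
  unfold mutualEnergy
  rw [lintegral_prod _ hK.ennreal_ofReal.aemeasurable,
    lintegral_prod_symm _ hK.ennreal_ofReal.aemeasurable]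
  simp_rw [hs]

/-- The energy of the difference `m₁ - m₂` of two finite measures, expanded by bilinearity. The
Jordan decomposition of `m₁ - m₂` enters only through `m₁ + ν⁻ = m₂ + ν⁺`. -/
theorem signedEnergy_sub [TopologicalSpace Y] {K : Y → Y → ℝ}
    (hK : Measurable fun z : Y × Y => K z.1 z.2) (hs : ∀ x y, K x y = K y x)
    (h0 : ∀ x y, 0 ≤ K x y) {M : ℝ} (hM : ∀ x y, K x y ≤ M)
    (m₁ m₂ : Measure Y) [IsFiniteMeasure m₁] [IsFiniteMeasure m₂] :
    signedEnergy K (m₁.toSignedMeasure - m₂.toSignedMeasure) =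
      (((mutualEnergy K m₁ m₁).toReal + (mutualEnergy K m₂ m₂).toReal
        - 2 * (mutualEnergy K m₁ m₂).toReal : ℝ) : EReal) := by
  set ν := m₁.toSignedMeasure - m₂.toSignedMeasure with hν
  set P := ν.toJordanDecomposition.posPart with hP
  set N := ν.toJordanDecomposition.negPart with hN
  have hPN : P.toSignedMeasure - N.toSignedMeasure = ν :=
    SignedMeasure.toSignedMeasure_toJordanDecomposition ν
  have hsum : m₁ + N = m₂ + P := by
    rw [← Measure.toSignedMeasure_eq_toSignedMeasure_iff, Measure.toSignedMeasure_add,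
      Measure.toSignedMeasure_add]
    have h := sub_eq_sub_iff_add_eq_add.1 (hPN.trans hν)
    rw [add_comm m₂.toSignedMeasure, h]
  have fin : ∀ a b : Measure Y, IsFiniteMeasure a → IsFiniteMeasure b →
      mutualEnergy K a b ≠ ∞ := fun a b _ _ => mutualEnergy_ne_top hM a b
  have key : ∀ a : Measure Y, IsFiniteMeasure a →
      (mutualEnergy K m₁ a).toReal + (mutualEnergy K N a).toReal =
        (mutualEnergy K m₂ a).toReal + (mutualEnergy K P a).toReal := by
    intro a ha
    rw [← ENNReal.toReal_add (fin _ _ inferInstance ha) (fin _ _ inferInstance ha),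
      ← ENNReal.toReal_add (fin _ _ inferInstance ha) (fin _ _ inferInstance ha),
      ← mutualEnergy_add_left, ← mutualEnergy_add_left, hsum]
  have hneg : ∀ z : Y × Y, ENNReal.ofReal (-K z.1 z.2) = 0 := fun z =>
    ENNReal.ofReal_of_nonpos (neg_nonpos.2 (h0 _ _))
  have epos : energyPos K ν = mutualEnergy K P P + mutualEnergy K N N := by
    simp only [energyPos, prodPos, hneg, lintegral_zero, add_zero, lintegral_add_measure]
    rfl
  have eneg : energyNeg K ν = mutualEnergy K P N + mutualEnergy K N P := by
    simp only [energyNeg, prodNeg, hneg, lintegral_zero, add_zero, lintegral_add_measure]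
    rfl
  have f1 := fin P P inferInstance inferInstance
  have f2 := fin N N inferInstance inferInstance
  have f3 := fin P N inferInstance inferInstance
  have f4 := fin N P inferInstance inferInstance
  rw [signedEnergy, epos, eneg, ← ENNReal.ofReal_toReal (ENNReal.add_ne_top.2 ⟨f1, f2⟩),
    ← ENNReal.ofReal_toReal (ENNReal.add_ne_top.2 ⟨f3, f4⟩), EReal.coe_ennreal_ofReal,
    EReal.coe_ennreal_ofReal, max_eq_left ENNReal.toReal_nonneg,
    max_eq_left ENNReal.toReal_nonneg, ← EReal.coe_sub, ENNReal.toReal_add f1 f2,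
    ENNReal.toReal_add f3 f4]
  congr 1
  have k1 := key m₁ inferInstance
  have k2 := key m₂ inferInstance
  have k3 := key P inferInstance
  have k4 := key N inferInstance
  rw [mutualEnergy_comm hK hs P m₁, mutualEnergy_comm hK hs N m₁,
    mutualEnergy_comm hK hs m₂ m₁] at *
  rw [mutualEnergy_comm hK hs P m₂, mutualEnergy_comm hK hs N m₂] at *
  rw [mutualEnergy_comm hK hs N P] at *
  linarith

theorem IsISPD.two_mul_mutualEnergy_le [TopologicalSpace Y] {K : Y → Y → ℝ} (hI : IsISPD K)
    (hK : Measurable fun z : Y × Y => K z.1 z.2) (h0 : ∀ x y, 0 ≤ K x y) {M : ℝ}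
    (hM : ∀ x y, K x y ≤ M) (m₁ m₂ : Measure Y) [IsFiniteMeasure m₁] [IsFiniteMeasure m₂] :
    2 * mutualEnergy K m₁ m₂ ≤ mutualEnergy K m₁ m₁ + mutualEnergy K m₂ m₂ := by
  have h := hI.nonneg (m₁.toSignedMeasure - m₂.toSignedMeasure)
  rw [signedEnergy_sub hK hI.symm h0 hM, EReal.coe_nonneg] at h
  have f := fun a b : Measure Y => fun (_ : IsFiniteMeasure a) (_ : IsFiniteMeasure b) =>
    mutualEnergy_ne_top hM a b
  rw [← ENNReal.toReal_le_toReal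
    (ENNReal.mul_ne_top ENNReal.ofNat_ne_top (f _ _ inferInstance inferInstance))
    (ENNReal.add_ne_top.2 ⟨f _ _ inferInstance inferInstance, f _ _ inferInstance inferInstance⟩),
    ENNReal.toReal_add (f _ _ inferInstance inferInstance) (f _ _ inferInstance inferInstance),
    ENNReal.toReal_mul, ENNReal.toReal_ofNat]
  linarith

theorem IsISPD.eq_of_mutualEnergy_le [TopologicalSpace Y] {K : Y → Y → ℝ} (hI : IsISPD K)
    (hK : Measurable fun z : Y × Y => K z.1 z.2) (h0 : ∀ x y, 0 ≤ K x y) {M : ℝ}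
    (hM : ∀ x y, K x y ≤ M) (m₁ m₂ : Measure Y) [IsFiniteMeasure m₁] [IsFiniteMeasure m₂]
    (h : mutualEnergy K m₁ m₁ + mutualEnergy K m₂ m₂ ≤ 2 * mutualEnergy K m₁ m₂) : m₁ = m₂ := by
  have h' := le_antisymm h (hI.two_mul_mutualEnergy_le hK h0 hM m₁ m₂)
  have f := fun a b : Measure Y => fun (_ : IsFiniteMeasure a) (_ : IsFiniteMeasure b) =>
    mutualEnergy_ne_top hM a b
  have h2 := congrArg ENNReal.toReal h'
  rw [ENNReal.toReal_add (f _ _ inferInstance inferInstance) (f _ _ inferInstance inferInstance),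
    ENNReal.toReal_mul, ENNReal.toReal_ofNat] at h2
  have := hI.eq_zero (m₁.toSignedMeasure - m₂.toSignedMeasure) (by
    rw [signedEnergy_sub hK hI.symm h0 hM, h2, sub_self, EReal.coe_zero])
  rwa [sub_eq_zero, Measure.toSignedMeasure_eq_toSignedMeasure_iff] at this

end Pairs

/-! ### Convolution kernels on `ℝⁿ` that are positive definite on a subset -/

section Translation

variable {n : ℕ}

/-- The mutual energy `∬ φ(x - y) dm₁(x) dm₂(y)` of two measures on `ℝⁿ`. -/
noncomputable abbrev convEnergy (φ : E n → ℝ) (m₁ m₂ : Measure (E n)) : ℝ≥0∞ :=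
  mutualEnergy (fun x y => φ (x - y)) m₁ m₂

/-- `φ` is a bounded, even, nonnegative continuous function whose convolution kernel is integrally
strictly positive definite on `X`. -/
structure IsAdmissible (X : Set (E n)) (φ : E n → ℝ) : Prop where
  continuous : Continuous φ
  nonneg : ∀ x, 0 ≤ φ x
  even : ∀ x, φ (-x) = φ x
  bddAbove : BddAbove (range φ)
  ispd : IsISPD fun x y : X => φ ((x : E n) - (y : E n))

theorem mutualEnergy_map {Y Y' : Type*} [MeasurableSpace Y] [MeasurableSpace Y'] {K : Y → Y → ℝ}
    (hK : Measurable fun z : Y × Y => K z.1 z.2) {f : Y' → Y} (hf : Measurable f)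
    (m₁ m₂ : Measure Y') [SFinite m₁] [SFinite m₂] :
    mutualEnergy K (m₁.map f) (m₂.map f) = mutualEnergy (fun x y => K (f x) (f y)) m₁ m₂ := by
  unfold mutualEnergy
  rw [Measure.map_prod_map _ _ hf hf, lintegral_map hK.ennreal_ofReal (hf.prodMap hf)]
  rfl

theorem IsAdmissible.measurable_kernel {X : Set (E n)} {φ : E n → ℝ} (h : IsAdmissible X φ) :
    Measurable fun z : E n × E n => φ (z.1 - z.2) :=
  (h.continuous.comp (continuous_fst.sub continuous_snd)).measurable

theorem mutualEnergy_comap_val {X : Set (E n)} (hX : MeasurableSet X) {φ : E n → ℝ}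
    (h : IsAdmissible X φ) (m₁ m₂ : Measure (E n)) [IsFiniteMeasure m₁] [IsFiniteMeasure m₂]
    (h₁ : m₁ Xᶜ = 0) (h₂ : m₂ Xᶜ = 0) :
    mutualEnergy (fun x y : X => φ ((x : E n) - (y : E n))) (m₁.comap (↑)) (m₂.comap (↑)) =
      convEnergy φ m₁ m₂ := by
  have e : ∀ m : Measure (E n), m Xᶜ = 0 → (m.comap ((↑) : X → E n)).map (↑) = m := fun m hm => by
    rw [map_comap_subtype_coe hX, Measure.restrict_eq_self_of_ae_mem]
    exact hm
  conv_rhs => rw [← e m₁ h₁, ← e m₂ h₂]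
  exact (mutualEnergy_map (K := fun x y => φ (x - y)) h.measurable_kernel
    measurable_subtype_coe _ _).symm

theorem IsAdmissible.two_mul_convEnergy_le {X : Set (E n)} (hX : MeasurableSet X) {φ : E n → ℝ}
    (h : IsAdmissible X φ) (m₁ m₂ : Measure (E n)) [IsFiniteMeasure m₁] [IsFiniteMeasure m₂]
    (h₁ : m₁ Xᶜ = 0) (h₂ : m₂ Xᶜ = 0) :
    2 * convEnergy φ m₁ m₂ ≤ convEnergy φ m₁ m₁ + convEnergy φ m₂ m₂ := by
  obtain ⟨M, hM⟩ := h.bddAbove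
  rw [← mutualEnergy_comap_val hX h m₁ m₂ h₁ h₂, ← mutualEnergy_comap_val hX h m₁ m₁ h₁ h₁,
    ← mutualEnergy_comap_val hX h m₂ m₂ h₂ h₂]
  exact h.ispd.two_mul_mutualEnergy_le
    (h.measurable_kernel.comp (measurable_subtype_coe.prodMap measurable_subtype_coe))
    (fun _ _ => h.nonneg _) (fun _ _ => hM (mem_range_self _)) _ _

theorem IsAdmissible.eq_of_convEnergy_le {X : Set (E n)} (hX : MeasurableSet X) {φ : E n → ℝ}
    (h : IsAdmissible X φ) (m₁ m₂ : Measure (E n)) [IsFiniteMeasure m₁] [IsFiniteMeasure m₂]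
    (h₁ : m₁ Xᶜ = 0) (h₂ : m₂ Xᶜ = 0)
    (hle : convEnergy φ m₁ m₁ + convEnergy φ m₂ m₂ ≤ 2 * convEnergy φ m₁ m₂) : m₁ = m₂ := by
  obtain ⟨M, hM⟩ := h.bddAbove
  rw [← mutualEnergy_comap_val hX h m₁ m₂ h₁ h₂, ← mutualEnergy_comap_val hX h m₁ m₁ h₁ h₁,
    ← mutualEnergy_comap_val hX h m₂ m₂ h₂ h₂] at hle
  have := h.ispd.eq_of_mutualEnergy_le
    (h.measurable_kernel.comp (measurable_subtype_coe.prodMap measurable_subtype_coe))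
    (fun _ _ => h.nonneg _) (fun _ _ => hM (mem_range_self _)) _ _ hle
  have h3 := congrArg (fun m => Measure.map ((↑) : X → E n) m) this
  simp only [map_comap_subtype_coe hX] at h3
  rwa [Measure.restrict_eq_self_of_ae_mem h₁, Measure.restrict_eq_self_of_ae_mem h₂] at h3

end Translation

/-! ### Averaging over translations -/

section Averaging

variable {n : ℕ}

/-- The volume of the set of translations that move both `x` and `y` into `A`; it depends only on
`x - y` and is the (unnormalized) autocorrelation of `A`. -/
noncomputable def overlap (A : Set (E n)) (x y : E n) : ℝ≥0∞ :=
  volume {r : E n | x + r ∈ A ∧ y + r ∈ A}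

theorem overlap_le (A : Set (E n)) (x y : E n) : overlap A x y ≤ volume A := by
  rw [← measure_preimage_add volume x A]
  exact measure_mono fun r hr => hr.1

open scoped Pointwise in
theorem exists_overlap_ge {A : Set (E n)} (hA : IsCompact A) {η : ℝ≥0∞} (hη : η ≠ 0) :
    ∃ δ > 0, ∀ x y : E n, dist x y < δ → volume A - η ≤ overlap A x y := by
  have h := eventually_nhds_zero_measure_vadd_sdiff_lt (μ := (volume : Measure (E n)))
    hA hA.isClosed hη
  obtain ⟨δ, hδ, h⟩ := Metric.eventually_nhds_iff.1 h
  refine ⟨δ, hδ, fun x y hxy => ?_⟩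
  have h' := h (y := x - y) (by rwa [dist_zero_right, ← dist_eq_norm])
  -- in the variable `x + r`, the set of translations is `A ∩ ((x - y) + A)`
  have e : overlap A x y = volume (((x - y) +ᵥ A) ∩ A) := by
    rw [← measure_preimage_add volume x (((x - y) +ᵥ A) ∩ A)]
    refine congrArg volume (Set.ext fun r => ?_)
    simp only [mem_ofPred_eq, mem_preimage, mem_inter_iff, mem_vadd_set_iff_neg_vadd_mem,
      vadd_eq_add]
    rw [show -(x - y) + (x + r) = y + r by abel, and_comm]
  rw [e, tsub_le_iff_right]
  calc volume A = volume ((x - y) +ᵥ A) := (measure_vadd _ _ _).symm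
    _ ≤ volume (((x - y) +ᵥ A) ∩ A) + volume (((x - y) +ᵥ A) \ A) :=
        measure_le_inter_add_sdiff _ _ _
    _ ≤ _ := by gcongr

/-- The set of pairs `(r, (x, y))` such that both `x + r` and `y + r` are in `A`. -/
def translationSet (A : Set (E n)) : Set (E n × E n × E n) :=
  {q | q.2.1 + q.1 ∈ A ∧ q.2.2 + q.1 ∈ A}

theorem measurableSet_translationSet {A : Set (E n)} (hA : MeasurableSet A) :
    MeasurableSet (translationSet A) := by
  refine MeasurableSet.inter ?_ ?_
  · exact (measurable_snd.fst.add measurable_fst) hA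
  · exact (measurable_snd.snd.add measurable_fst) hA

/-- The measure `m`, translated by `r` and restricted to `A`. -/
noncomputable def translateRestrict (A : Set (E n)) (r : E n) (m : Measure (E n)) :
    Measure (E n) :=
  (m.restrict ((· + r) ⁻¹' A)).map (· + r)

instance (A : Set (E n)) (r : E n) (m : Measure (E n)) [IsFiniteMeasure m] :
    IsFiniteMeasure (translateRestrict A r m) := by
  unfold translateRestrict; infer_instance

theorem translateRestrict_compl {A X : Set (E n)} (hX : MeasurableSet X) (hAX : A ⊆ X) (r : E n)
    (m : Measure (E n)) : translateRestrict A r m Xᶜ = 0 := by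
  have hm : Measurable fun x : E n => x + r := measurable_add_const r
  rw [translateRestrict, Measure.map_apply hm hX.compl, Measure.restrict_apply (hm hX.compl)]
  convert measure_empty (μ := m)
  ext x
  simp only [mem_inter_iff, mem_preimage, mem_compl_iff, mem_empty_iff_false, iff_false]
  exact fun h => h.1 (hAX h.2)

theorem convEnergy_translateRestrict {A X : Set (E n)} (hA : MeasurableSet A) {φ : E n → ℝ}
    (h : IsAdmissible X φ) (r : E n) (m₁ m₂ : Measure (E n)) [SFinite m₁] [SFinite m₂] :
    convEnergy φ (translateRestrict A r m₁) (translateRestrict A r m₂) =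
      ∫⁻ z, ENNReal.ofReal (φ (z.1 - z.2)) * (translationSet A).indicator 1 (r, z)
        ∂(m₁.prod m₂) := by
  have hm : Measurable fun x : E n => x + r := measurable_add_const r
  rw [convEnergy, translateRestrict, translateRestrict,
    mutualEnergy_map (K := fun x y => φ (x - y)) h.measurable_kernel hm]
  simp only [add_sub_add_right_eq_sub]
  rw [mutualEnergy, Measure.prod_restrict, ← lintegral_indicator ((hm hA).prod (hm hA))]
  refine lintegral_congr fun z => ?_
  by_cases hz : z.1 + r ∈ A ∧ z.2 + r ∈ A
  · rw [indicator_of_mem (by exact hz), indicator_of_mem (by exact hz), Pi.one_apply, mul_one]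
  · rw [indicator_of_notMem (by exact hz), indicator_of_notMem (by exact hz), mul_zero]

theorem lintegral_convEnergy_translateRestrict {A X : Set (E n)} (hA : MeasurableSet A)
    {φ : E n → ℝ} (h : IsAdmissible X φ) (m₁ m₂ : Measure (E n)) [SFinite m₁] [SFinite m₂] :
    ∫⁻ r, convEnergy φ (translateRestrict A r m₁) (translateRestrict A r m₂) =
      ∫⁻ z, ENNReal.ofReal (φ (z.1 - z.2)) * overlap A z.1 z.2 ∂(m₁.prod m₂) := by
  have hS := measurableSet_translationSet hA
  have hm : Measurable fun q : E n × E n × E n =>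
      ENNReal.ofReal (φ (q.2.1 - q.2.2)) * (translationSet A).indicator 1 q :=
    ((h.measurable_kernel.comp measurable_snd).ennreal_ofReal).mul
      (measurable_one.indicator hS)
  simp_rw [convEnergy_translateRestrict hA h]
  rw [lintegral_lintegral_swap hm.aemeasurable]
  refine lintegral_congr fun z => ?_
  have hz : Measurable fun r : E n => (r, z) := measurable_id.prodMk measurable_const
  rw [lintegral_const_mul' _ _ ENNReal.ofReal_ne_top]
  congr 1
  exact lintegral_indicator_one (hz hS)

/-- The autocorrelation trick. Strict positive definiteness is only available on `X`, but the
kernel `φ(x - y)` times the autocorrelation of any `A ⊆ X` is positive definite on all of `ℝⁿ`: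
translate the measures by `r`, restrict them to `A`, and average over `r`. -/
theorem IsAdmissible.two_mul_lintegral_overlap_le {A X : Set (E n)} (hA : MeasurableSet A)
    (hX : MeasurableSet X) (hAX : A ⊆ X) {φ : E n → ℝ} (h : IsAdmissible X φ)
    (m₁ m₂ : Measure (E n)) [IsFiniteMeasure m₁] [IsFiniteMeasure m₂] :
    2 * ∫⁻ z, ENNReal.ofReal (φ (z.1 - z.2)) * overlap A z.1 z.2 ∂(m₁.prod m₂) ≤
      volume A * (convEnergy φ m₁ m₁ + convEnergy φ m₂ m₂) := by
  have hφ := h.measurable_kernel.ennreal_ofReal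
  have bound : ∀ m : Measure (E n), IsFiniteMeasure m →
      ∫⁻ r, convEnergy φ (translateRestrict A r m) (translateRestrict A r m) ≤
        volume A * convEnergy φ m m := by
    intro m _
    rw [lintegral_convEnergy_translateRestrict hA h, convEnergy, mutualEnergy,
      ← lintegral_const_mul _ hφ]
    refine lintegral_mono fun z => ?_
    rw [mul_comm]
    gcongr
    exact overlap_le A _ _
  have meas : ∀ m : Measure (E n), IsFiniteMeasure m →
      Measurable fun r => convEnergy φ (translateRestrict A r m) (translateRestrict A r m) := by
    intro m _
    simp_rw [convEnergy_translateRestrict hA h]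
    exact Measurable.lintegral_prod_right' (f := fun q : E n × E n × E n =>
      ENNReal.ofReal (φ (q.2.1 - q.2.2)) * (translationSet A).indicator 1 q)
      (((h.measurable_kernel.comp measurable_snd).ennreal_ofReal).mul
        (measurable_one.indicator (measurableSet_translationSet hA)))
  rw [← lintegral_convEnergy_translateRestrict hA h, mul_add]
  refine le_trans ?_ (add_le_add (bound m₁ inferInstance) (bound m₂ inferInstance))
  rw [← lintegral_add_left (meas m₁ inferInstance), ← lintegral_const_mul' _ _ (by simp)]
  exact lintegral_mono fun r => h.two_mul_convEnergy_le hX _ _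
    (translateRestrict_compl hX hAX r m₁) (translateRestrict_compl hX hAX r m₂)

end Averaging

/-! ### Mollifiers -/

section Mollifier

variable {n : ℕ} {φ : ℝ → E n → ℝ}

theorem IsMollifierFamily.measurable (hφ : IsMollifierFamily φ) {ε : ℝ} (hε : 0 < ε) :
    Measurable (φ ε) := (hφ.contDiff ε hε).continuous.measurable

theorem IsMollifierFamily.lintegral_eq_one (hφ : IsMollifierFamily φ) {ε : ℝ} (hε : 0 < ε) :
    ∫⁻ x, ENNReal.ofReal (φ ε x) = 1 := by
  rw [← hφ.norm_one ε hε, eLpNorm_one_eq_lintegral_enorm]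
  exact lintegral_congr fun x => (Real.enorm_of_nonneg (hφ.nonneg ε hε x)).symm

theorem IsMollifierFamily.lintegral_sub_left (hφ : IsMollifierFamily φ) {ε : ℝ} (hε : 0 < ε)
    (x : E n) : ∫⁻ y, ENNReal.ofReal (φ ε (x - y)) = 1 := by
  rw [← hφ.lintegral_eq_one hε]
  exact lintegral_sub_left_eq_self (fun y => ENNReal.ofReal (φ ε y)) x

theorem IsMollifierFamily.lintegral_sub_right (hφ : IsMollifierFamily φ) {ε : ℝ} (hε : 0 < ε)
    (y : E n) : ∫⁻ x, ENNReal.ofReal (φ ε (x - y)) = 1 := by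
  rw [← hφ.lintegral_eq_one hε]
  exact lintegral_sub_right_eq_self (fun y => ENNReal.ofReal (φ ε y)) y

theorem IsMollifierFamily.eventually_setLIntegral_ball_ge (hφ : IsMollifierFamily φ) {δ : ℝ}
    (hδ : 0 < δ) {η : ℝ≥0∞} (hη : η ≠ 0) :
    ∀ᶠ ε in 𝓝[>] (0 : ℝ),
      1 - η ≤ ∫⁻ x in Metric.ball (0 : E n) δ, ENNReal.ofReal (φ ε x) := by
  have h := (hφ.tendsto_one δ hδ).eventually_lt_const (pos_iff_ne_zero.2 hη)
  filter_upwards [h, self_mem_nhdsWithin] with ε h hε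
  rw [eLpNorm_indicator_eq_eLpNorm_restrict Metric.isOpen_ball.measurableSet.compl,
    eLpNorm_one_eq_lintegral_enorm] at h
  simp_rw [Real.enorm_of_nonneg (hφ.nonneg ε hε _)] at h
  rw [tsub_le_iff_right, ← hφ.lintegral_eq_one hε,
    ← lintegral_add_compl _ (measurableSet_ball (x := (0 : E n)) (ε := δ))]
  gcongr

theorem setLIntegral_ball_sub (f : E n → ℝ≥0∞) (x : E n) (δ : ℝ) :
    ∫⁻ y in Metric.ball x δ, f (x - y) = ∫⁻ y in Metric.ball 0 δ, f y := by
  rw [← lintegral_indicator Metric.isOpen_ball.measurableSet,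
    ← lintegral_indicator Metric.isOpen_ball.measurableSet,
    ← lintegral_sub_left_eq_self ((Metric.ball 0 δ).indicator f) x]
  refine lintegral_congr fun y => ?_
  have : y ∈ Metric.ball x δ ↔ x - y ∈ Metric.ball (0 : E n) δ := by
    rw [Metric.mem_ball', mem_ball_zero_iff, dist_eq_norm]
  by_cases hy : y ∈ Metric.ball x δ
  · rw [indicator_of_mem hy, indicator_of_mem (this.1 hy)]
  · rw [indicator_of_notMem hy, indicator_of_notMem (mt this.2 hy)]

theorem two_mul_mul_le_sq_add_sq (a b : ℝ≥0∞) : 2 * (a * b) ≤ a ^ 2 + b ^ 2 := by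
  rcases le_total a b with h | h
  · obtain ⟨c, rfl⟩ := exists_add_of_le h
    calc 2 * (a * (a + c)) ≤ 2 * (a * (a + c)) + c ^ 2 := le_self_add
      _ = _ := by ring
  · obtain ⟨c, rfl⟩ := exists_add_of_le h
    calc 2 * ((b + c) * b) ≤ 2 * ((b + c) * b) + c ^ 2 := le_self_add
      _ = _ := by ring

theorem convEnergy_withDensity {φ : E n → ℝ} (hφ : Measurable φ) {m : Measure (E n)} [SFinite m]
    {f g : E n → ℝ≥0∞} (hf : Measurable f) (hg : Measurable g) :
    convEnergy φ (m.withDensity f) (m.withDensity g) =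
      ∫⁻ z, ENNReal.ofReal (φ (z.1 - z.2)) * (f z.1 * g z.2) ∂(m.prod m) := by
  have hk : Measurable fun z : E n × E n => ENNReal.ofReal (φ (z.1 - z.2)) :=
    (hφ.comp (measurable_fst.sub measurable_snd)).ennreal_ofReal
  have hfg : Measurable fun z : E n × E n => f z.1 * g z.2 :=
    (hf.comp measurable_fst).mul (hg.comp measurable_snd)
  rw [convEnergy, mutualEnergy, prod_withDensity hf hg,
    lintegral_withDensity_eq_lintegral_mul _ hfg hk]
  refine lintegral_congr fun z => ?_
  rw [Pi.mul_apply, mul_comm]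

/-- Convolution with a mollifier has norm at most `1` on `L²`. -/
theorem IsMollifierFamily.convEnergy_withDensity_le (hφ : IsMollifierFamily φ) {ε : ℝ}
    (hε : 0 < ε) {g : E n → ℝ≥0∞} (hg : Measurable g) :
    convEnergy (φ ε) (volume.withDensity g) (volume.withDensity g) ≤ ∫⁻ x, g x ^ 2 := by
  have hk : Measurable fun z : E n × E n => ENNReal.ofReal (φ ε (z.1 - z.2)) :=
    ((hφ.measurable hε).comp (measurable_fst.sub measurable_snd)).ennreal_ofReal
  have m1 : Measurable fun z : E n × E n => ENNReal.ofReal (φ ε (z.1 - z.2)) * g z.1 ^ 2 :=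
    hk.mul ((hg.comp measurable_fst).pow_const 2)
  have m2 : Measurable fun z : E n × E n => ENNReal.ofReal (φ ε (z.1 - z.2)) * g z.2 ^ 2 :=
    hk.mul ((hg.comp measurable_snd).pow_const 2)
  have h1 : ∫⁻ z : E n × E n, ENNReal.ofReal (φ ε (z.1 - z.2)) * g z.1 ^ 2
      ∂(volume.prod volume) = ∫⁻ x, g x ^ 2 := by
    rw [lintegral_prod _ m1.aemeasurable]
    refine lintegral_congr fun x => ?_
    dsimp only
    have hx : Measurable fun y => ENNReal.ofReal (φ ε (x - y)) := hk.comp measurable_prodMk_left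
    rw [lintegral_mul_const _ hx,
      hφ.lintegral_sub_left hε, one_mul]
  have h2 : ∫⁻ z : E n × E n, ENNReal.ofReal (φ ε (z.1 - z.2)) * g z.2 ^ 2
      ∂(volume.prod volume) = ∫⁻ x, g x ^ 2 := by
    rw [lintegral_prod_symm _ m2.aemeasurable]
    refine lintegral_congr fun x => ?_
    dsimp only
    have hx : Measurable fun y => ENNReal.ofReal (φ ε (y - x)) := hk.comp measurable_prodMk_right
    rw [lintegral_mul_const _ hx,
      hφ.lintegral_sub_right hε,
      one_mul]
  rw [convEnergy_withDensity (hφ.measurable hε) hg hg]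
  refine (ENNReal.mul_le_mul_iff_right (a := 2) (by simp) (by simp)).1 ?_
  rw [two_mul (∫⁻ x, g x ^ 2)]
  nth_rw 1 [← h1]
  rw [← h2, ← lintegral_add_left m1,
    ← lintegral_const_mul' _ _ (by simp)]
  refine lintegral_mono fun z => ?_
  rw [← mul_add, mul_left_comm]
  gcongr
  exact two_mul_mul_le_sq_add_sq _ _

end Mollifier

/-! ### Passing to the limit in the test inequality -/

section Limit

variable {n : ℕ} {X : Set (E n)} {φ : ℝ → E n → ℝ}

theorem measurable_overlap {A : Set (E n)} (hA : MeasurableSet A) :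
    Measurable fun z : E n × E n => overlap A z.1 z.2 :=
  measurable_measure_prodMk_right (measurableSet_translationSet hA)

open NNReal in
/-- The kernel `φ_ε(x - y) · overlap A x y` is asymptotically `vol A` times an approximate identity,
uniformly in `x`. -/
theorem IsMollifierFamily.eventually_le_lintegral_overlap (hφ : IsMollifierFamily φ)
    {A : Set (E n)} (hA : IsCompact A) {h : E n → ℝ≥0} (hh : UniformContinuous h) {η : ℝ≥0}
    (hη : 0 < η) :
    ∀ᶠ ε in 𝓝[>] (0 : ℝ), ∀ x, (volume A - η) * (1 - η) * ((h x - η : ℝ≥0) : ℝ≥0∞) ≤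
      ∫⁻ y, ENNReal.ofReal (φ ε (x - y)) * overlap A x y * h y := by
  obtain ⟨δ₁, hδ₁, h₁⟩ := exists_overlap_ge hA (η := η) (by simpa using hη.ne')
  obtain ⟨δ₂, hδ₂, h₂⟩ := Metric.uniformContinuous_iff.1 hh η hη
  filter_upwards [hφ.eventually_setLIntegral_ball_ge (lt_min hδ₁ hδ₂) (η := η)
    (by simpa using hη.ne'), self_mem_nhdsWithin] with ε hball hε x
  calc (volume A - η) * (1 - η) * ((h x - η : ℝ≥0) : ℝ≥0∞)
      ≤ (volume A - η) * (∫⁻ y in Metric.ball x (min δ₁ δ₂), ENNReal.ofReal (φ ε (x - y))) *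
          ((h x - η : ℝ≥0) : ℝ≥0∞) := by
        rw [setLIntegral_ball_sub (fun y => ENNReal.ofReal (φ ε y))]
        gcongr
    _ = ∫⁻ y in Metric.ball x (min δ₁ δ₂), ENNReal.ofReal (φ ε (x - y)) * (volume A - η) *
          ((h x - η : ℝ≥0) : ℝ≥0∞) := by
        rw [lintegral_mul_const' _ _ ENNReal.coe_ne_top, lintegral_mul_const' _ _
          (ne_top_of_le_ne_top hA.measure_lt_top.ne tsub_le_self), mul_comm (volume A - η)]
    _ ≤ ∫⁻ y in Metric.ball x (min δ₁ δ₂), ENNReal.ofReal (φ ε (x - y)) * overlap A x y * h y := by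
        refine setLIntegral_mono' Metric.isOpen_ball.measurableSet fun y hy => ?_
        have hy' := Metric.mem_ball'.1 hy
        gcongr
        · exact h₁ x y (hy'.trans_le (min_le_left _ _))
        · have := h₂ (hy'.trans_le (min_le_right _ _))
          rw [NNReal.dist_eq] at this
          have := (abs_lt.1 this).2
          rw [tsub_le_iff_right, ← NNReal.coe_le_coe, NNReal.coe_add]
          linarith
    _ ≤ _ := setLIntegral_le_lintegral _ _

open NNReal BoundedContinuousFunction in
/-- Along a weakly convergent family, positive definiteness tested against the measures `h dx`
gives in the limit `2 ∫ h ψ dμ₀ ≤ L + ∫ h²`, where `L` bounds the energies of `ψ μ_ε`. -/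
theorem two_mul_lintegral_le_of_tendsto (hX : IsClosed X) (hXvol : 0 < volume X)
    (hφ : IsMollifierFamily φ) (hadm : ∀ ε > 0, IsAdmissible X (φ ε)) {l : Filter ℝ}
    (hl : l ≤ 𝓝[>] 0) {μ : ℝ → ProbabilityMeasure (E n)} {μ₀ : ProbabilityMeasure (E n)}
    (hμ : Tendsto μ l (𝓝 μ₀)) (ψ : E n →ᵇ ℝ≥0) {L : ℝ≥0∞}
    (hL : ∃ᶠ ε in l, convEnergy (φ ε) ((μ ε : Measure (E n)).withDensity fun x => ψ x)
      ((μ ε : Measure (E n)).withDensity fun x => ψ x) ≤ L)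
    {h : E n → ℝ≥0} (hh : Continuous h) (hhc : HasCompactSupport h) :
    2 * ∫⁻ x, ψ x * h x ∂(μ₀ : Measure (E n)) ≤ L + ∫⁻ x, (h x : ℝ≥0∞) ^ 2 := by
  obtain ⟨A, hAX, hA, hApos⟩ := hX.measurableSet.exists_lt_isCompact hXvol
  have hψm : Measurable fun x => (ψ x : ℝ≥0∞) := ψ.continuous.measurable.coe_nnreal_ennreal
  have hhm : Measurable fun x => (h x : ℝ≥0∞) := hh.measurable.coe_nnreal_ennreal
  have hhi : ∫⁻ x, (h x : ℝ≥0∞) ≠ ∞ := by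
    have := ((NNReal.continuous_coe.comp hh).integrable_of_hasCompactSupport (μ := volume)
      (hhc.comp_left NNReal.coe_zero)).hasFiniteIntegral
    simpa [HasFiniteIntegral] using this.ne
  have : IsFiniteMeasure (volume.withDensity fun x => (h x : ℝ≥0∞)) :=
    isFiniteMeasure_withDensity hhi
  have hfin : ∀ (μ : ProbabilityMeasure (E n)) , IsFiniteMeasure
      ((μ : Measure (E n)).withDensity fun x => (ψ x : ℝ≥0∞)) := fun μ =>
    isFiniteMeasure_withDensity (ψ.lintegral_lt_top_of_nnreal _).ne
  have hη : ∀ η : ℝ≥0, 0 < η →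
      2 * ((volume A - η) * (1 - η) * ∫⁻ x, (ψ x * (h x - η) : ℝ≥0) ∂(μ₀ : Measure (E n))) ≤
        volume A * (L + ∫⁻ x, (h x : ℝ≥0∞) ^ 2) := by
    intro η hη
    have hc : Continuous fun x => h x - η := hh.sub continuous_const
    obtain ⟨b, hb⟩ := HasCompactSupport.exists_bound_of_continuous
      (hhc.comp_left (g := ((↑) : ℝ≥0 → ℝ)) NNReal.coe_zero) (NNReal.continuous_coe.comp hh)
    have hbd : ∀ x, ((ψ x * (h x - η) : ℝ≥0) : ℝ) ≤ nndist ψ 0 * b := fun x => by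
      have h1 : (h x - η : ℝ≥0) ≤ h x := tsub_le_self
      have h2 := hb x
      rw [Function.comp_apply, Real.norm_of_nonneg (h x).coe_nonneg] at h2
      rw [NNReal.coe_mul]
      exact mul_le_mul (NNReal.upper_bound ψ x) ((NNReal.coe_le_coe.2 h1).trans h2)
        (NNReal.coe_nonneg _) (NNReal.coe_nonneg _)
    let f : E n →ᵇ ℝ≥0 := mkOfBound ⟨fun x => ψ x * (h x - η), ψ.continuous.mul hc⟩
      (nndist ψ 0 * b) fun x y => by
        rw [NNReal.dist_eq, abs_le]
        have h1 := hbd x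
        have h2 := hbd y
        have h3 := (ψ x * (h x - η)).coe_nonneg
        have h4 := (ψ y * (h y - η)).coe_nonneg
        constructor <;> dsimp only [ContinuousMap.coe_mk] <;> linarith
    have hf := ProbabilityMeasure.tendsto_iff_forall_lintegral_tendsto.1 hμ f
    have hc0 : (volume A - η) * (1 - η : ℝ≥0∞) ≠ ∞ := ENNReal.mul_ne_top
      (ne_top_of_le_ne_top hA.measure_lt_top.ne tsub_le_self)
      (ne_top_of_le_ne_top ENNReal.one_ne_top tsub_le_self)
    have hlim : Tendsto (fun ε => 2 * ((volume A - η) * (1 - η) *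
        ∫⁻ x, f x ∂(μ ε : Measure (E n)))) l
        (𝓝 (2 * ((volume A - η) * (1 - η) * ∫⁻ x, f x ∂(μ₀ : Measure (E n))))) :=
      ENNReal.Tendsto.const_mul (ENNReal.Tendsto.const_mul hf (Or.inr hc0)) (Or.inr (by simp))
    refine le_of_tendsto_of_frequently hlim ?_
    have hev := Filter.Eventually.filter_mono hl
      (hφ.eventually_le_lintegral_overlap hA (hhc.uniformContinuous_of_continuous hh) hη)
    have hpos : ∀ᶠ ε in l, 0 < ε := hl self_mem_nhdsWithin
    refine (hL.and_eventually (hev.and hpos)).mono fun ε ⟨hLε, hε, hε0⟩ => ?_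
    have hadmε := hadm ε hε0
    have := hfin (μ ε)
    have hov : Measurable fun z : E n × E n =>
        ENNReal.ofReal (φ ε (z.1 - z.2)) * overlap A z.1 z.2 :=
      hadmε.measurable_kernel.ennreal_ofReal.mul (measurable_overlap hA.measurableSet)
    calc 2 * ((volume A - η) * (1 - η) * ∫⁻ x, f x ∂(μ ε : Measure (E n)))
        = 2 * ∫⁻ x, ψ x * ((volume A - η) * (1 - η) * ((h x - η : ℝ≥0) : ℝ≥0∞))
            ∂(μ ε : Measure (E n)) := by
          rw [← lintegral_const_mul' _ _ hc0]
          refine congrArg (2 * ·) (lintegral_congr fun x => ?_)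
          rw [mul_left_comm, ← ENNReal.coe_mul]
          rfl
      _ ≤ 2 * ∫⁻ x, ψ x * (∫⁻ y, ENNReal.ofReal (φ ε (x - y)) * overlap A x y * h y)
            ∂(μ ε : Measure (E n)) := by
          gcongr with x
          exact hε x
      _ = 2 * ∫⁻ z, ENNReal.ofReal (φ ε (z.1 - z.2)) * overlap A z.1 z.2
            ∂(((μ ε : Measure (E n)).withDensity fun x => (ψ x : ℝ≥0∞)).prod
              (volume.withDensity fun x => (h x : ℝ≥0∞))) := by
          rw [lintegral_prod _ hov.aemeasurable,
            lintegral_withDensity_eq_lintegral_mul _ hψm hov.lintegral_prod_right']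
          refine congrArg (2 * ·) (lintegral_congr fun x => ?_)
          rw [Pi.mul_apply]
          congr 1
          dsimp only
          have hovx : Measurable fun y => ENNReal.ofReal (φ ε (x - y)) * overlap A x y :=
            hov.comp measurable_prodMk_left
          rw [lintegral_withDensity_eq_lintegral_mul _ hhm hovx]
          refine lintegral_congr fun y => ?_
          rw [Pi.mul_apply, mul_comm]
      _ ≤ _ := hadmε.two_mul_lintegral_overlap_le hA.measurableSet hX.measurableSet hAX _ _
      _ ≤ volume A * (L + ∫⁻ x, (h x : ℝ≥0∞) ^ 2) := by
          gcongr
          exact hφ.convEnergy_withDensity_le hε0 hhm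
  set Ψ := ∫⁻ x, ψ x ∂(μ₀ : Measure (E n)) with hΨ
  set I := ∫⁻ x, ψ x * h x ∂(μ₀ : Measure (E n)) with hI
  have hΨ' : Ψ ≠ ∞ := (ψ.lintegral_lt_top_of_nnreal _).ne
  have hη' : ∀ η : ℝ≥0, 0 < η → 2 * ((volume A - η) * (1 - η) * (I - η * Ψ)) ≤
      volume A * (L + ∫⁻ x, (h x : ℝ≥0∞) ^ 2) := by
    intro η h0
    refine le_trans ?_ (hη η h0)
    gcongr
    rw [tsub_le_iff_right, hΨ, ← lintegral_const_mul _ hψm, ← lintegral_add_right _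
      (hψm.const_mul _)]
    refine lintegral_mono fun x => ?_
    norm_cast
    rw [mul_comm η, ← mul_add]
    gcongr
    exact le_tsub_add
  have ht : Tendsto (fun η : ℝ≥0 => (η : ℝ≥0∞)) (𝓝[>] 0) (𝓝 0) :=
    (ENNReal.tendsto_coe.2 tendsto_id).mono_left nhdsWithin_le_nhds
  have hlim : Tendsto (fun η : ℝ≥0 => 2 * ((volume A - η) * (1 - η) * (I - η * Ψ)))
      (𝓝[>] 0) (𝓝 (2 * ((volume A - 0) * (1 - 0) * (I - 0 * Ψ)))) := by
    have hV : volume A ≠ ∞ := hA.measure_lt_top.ne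
    have t1 := ENNReal.Tendsto.sub (tendsto_const_nhds (x := volume A)) ht (Or.inl hV)
    have t2 := ENNReal.Tendsto.sub (tendsto_const_nhds (x := (1 : ℝ≥0∞))) ht (Or.inl (by simp))
    have t3 := ENNReal.Tendsto.sub (tendsto_const_nhds (x := I))
      (ENNReal.Tendsto.mul_const (b := Ψ) ht (Or.inr hΨ')) (Or.inr (by simp))
    have t12 := ENNReal.Tendsto.mul t1 (Or.inr (by simp)) t2 (Or.inr (by simpa using hV))
    refine ENNReal.Tendsto.const_mul (ENNReal.Tendsto.mul t12 (Or.inl ?_) t3 (Or.inr ?_))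
      (Or.inr (by simp))
    · simpa using hApos.ne'
    · simpa using hV
  have := le_of_tendsto hlim (by filter_upwards [self_mem_nhdsWithin] with η h0 using hη' η h0)
  rw [tsub_zero, tsub_zero, mul_one, zero_mul, tsub_zero, mul_left_comm] at this
  exact (ENNReal.mul_le_mul_iff_right hApos.ne' hA.measure_lt_top.ne).1 this

end Limit

/-! ### Duality: measures with a square integrable density -/

section Duality

variable {n : ℕ}

open NNReal in
/-- The test inequality extends from `C_c` to `L²`, by density of `C_c` in `L²(vol + m)`. -/
theorem two_mul_lintegral_le_of_forall_hasCompactSupport {m : Measure (E n)} [IsFiniteMeasure m]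
    {L : ℝ≥0∞}
    (H : ∀ h : E n → ℝ≥0, Continuous h → HasCompactSupport h →
      2 * ∫⁻ x, h x ∂m ≤ L + ∫⁻ x, (h x : ℝ≥0∞) ^ 2)
    {h : E n → ℝ≥0} (hh : Measurable h) (hv : ∫⁻ x, (h x : ℝ≥0∞) ^ 2 ≠ ∞)
    (hm : ∫⁻ x, (h x : ℝ≥0∞) ^ 2 ∂m ≠ ∞) :
    2 * ∫⁻ x, h x ∂m ≤ L + ∫⁻ x, (h x : ℝ≥0∞) ^ 2 := by
  set h' : E n → ℝ := fun x => h x with hh'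
  have hsq : ∀ (g : E n → ℝ) (ν : Measure (E n)), ∫⁻ x, ‖g x‖ₑ ^ 2 ∂ν = eLpNorm g 2 ν ^ 2 := by
    intro g ν
    have := eLpNorm_nnreal_pow_eq_lintegral (f := g) (μ := ν) (p := 2) (by simp)
    simpa using this.symm
  have hen : ∀ x, ‖h' x‖ₑ = h x := fun x => by simp [hh']
  have hsqh : ∀ ν : Measure (E n), ∫⁻ x, (h x : ℝ≥0∞) ^ 2 ∂ν = eLpNorm h' 2 ν ^ 2 := by
    intro ν
    rw [← hsq]
    simp_rw [hen]
  have hmeas : Measurable h' := hh.coe_nnreal_real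
  have hmem : MemLp h' 2 (volume + m) := by
    refine ⟨hmeas.aestronglyMeasurable, ?_⟩
    rw [lt_top_iff_ne_top]
    intro htop
    have := hsqh (volume + m)
    rw [lintegral_add_measure, htop] at this
    exact ENNReal.add_ne_top.2 ⟨hv, hm⟩ (by simpa using this)
  have ha : eLpNorm h' 2 volume ≠ ∞ := fun htop => hv (by rw [hsqh, htop]; simp)
  set a := eLpNorm h' 2 volume with ha'
  set c := m univ ^ (1 / (1 : ℝ≥0∞).toReal - 1 / (2 : ℝ≥0∞).toReal) with hc
  have hcfin : c ≠ ∞ := ENNReal.rpow_ne_top_of_nonneg (by norm_num) (measure_ne_top _ _)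
  have : IsLocallyFiniteMeasure (volume + m) := ⟨fun x => ⟨Metric.ball x 1,
    Metric.ball_mem_nhds x one_pos, by
      rw [Measure.add_apply]
      exact ENNReal.add_lt_top.2 ⟨measure_ball_lt_top, measure_lt_top _ _⟩⟩⟩
  have key : ∀ δ : ℝ≥0, 0 < δ → 2 * ∫⁻ x, h x ∂m ≤ L + (a + δ) ^ 2 + 2 * (δ * c) := by
    intro δ hδ
    obtain ⟨g, hgc, hgδ, hg, hgm⟩ := hmem.exists_hasCompactSupport_eLpNorm_sub_le
      (by simp) (ε := δ) (by simpa using hδ.ne')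
    have hv' : eLpNorm (h' - g) 2 volume ≤ δ :=
      (eLpNorm_mono_measure _ (Measure.le_add_right le_rfl)).trans hgδ
    have hm' : eLpNorm (h' - g) 2 m ≤ δ :=
      (eLpNorm_mono_measure _ (Measure.le_add_left le_rfl)).trans hgδ
    have hgn : eLpNorm g 2 volume ≤ a + δ := by
      have := eLpNorm_sub_le (μ := volume) (p := 2) (f := h') (g := h' - g)
        hmeas.aestronglyMeasurable (hmeas.sub hg.measurable).aestronglyMeasurable (by simp)
      rw [sub_sub_cancel] at this
      exact this.trans (by gcongr)
    have h1 : ∫⁻ x, ‖(h' - g) x‖ₑ ∂m ≤ δ * c := by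
      rw [← eLpNorm_one_eq_lintegral_enorm]
      refine (eLpNorm_le_eLpNorm_mul_rpow_measure_univ (q := 2) (by simp)
        (hmeas.sub hg.measurable).aestronglyMeasurable).trans ?_
      gcongr
    have h2 : ∫⁻ x, h x ∂m ≤ ∫⁻ x, ‖g x‖ₑ ∂m + δ * c := by
      refine le_trans ?_ (add_le_add_right h1 _)
      rw [← lintegral_add_left hg.measurable.enorm]
      refine lintegral_mono fun x => ?_
      rw [← hen]
      calc ‖h' x‖ₑ = ‖g x + (h' - g) x‖ₑ := by simp
        _ ≤ _ := enorm_add_le _ _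
    have h3 := H (fun x => ‖g x‖₊) hg.nnnorm (hgc.comp_left (g := fun y : ℝ => ‖y‖₊) nnnorm_zero)
    have h4 : 2 * ∫⁻ x, ‖g x‖ₑ ∂m ≤ L + (a + δ) ^ 2 := by
      refine h3.trans ?_
      gcongr
      refine le_trans (le_of_eq (hsq g volume)) ?_
      gcongr
    calc 2 * ∫⁻ x, h x ∂m ≤ 2 * (∫⁻ x, ‖g x‖ₑ ∂m + δ * c) := by gcongr
      _ ≤ _ := by rw [mul_add]; gcongr
  have ht : Tendsto (fun δ : ℝ≥0 => (δ : ℝ≥0∞)) (𝓝[>] 0) (𝓝 0) :=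
    (ENNReal.tendsto_coe.2 tendsto_id).mono_left nhdsWithin_le_nhds
  have hlim : Tendsto (fun δ : ℝ≥0 => L + (a + δ) ^ 2 + 2 * (δ * c)) (𝓝[>] 0)
      (𝓝 (L + (a + 0) ^ 2 + 2 * (0 * c))) := by
    refine Tendsto.add (Tendsto.add tendsto_const_nhds ?_) ?_
    · exact ENNReal.Tendsto.pow (tendsto_const_nhds.add ht)
    · exact ENNReal.Tendsto.const_mul (ENNReal.Tendsto.mul_const ht (Or.inr hcfin))
        (Or.inr (by simp))
  have := ge_of_tendsto hlim (by filter_upwards [self_mem_nhdsWithin] with η h0 using key η h0)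
  rw [hsqh]
  simpa using this

open NNReal in
theorem absolutelyContinuous_of_two_mul_lintegral_le {m : Measure (E n)} [IsFiniteMeasure m]
    {L : ℝ≥0∞} (hL : L ≠ ∞)
    (H : ∀ h : E n → ℝ≥0, Continuous h → HasCompactSupport h →
      2 * ∫⁻ x, h x ∂m ≤ L + ∫⁻ x, (h x : ℝ≥0∞) ^ 2) : m ≪ volume := by
  refine Measure.AbsolutelyContinuous.mk fun s hs hs0 => ?_
  by_contra hne
  -- test with large multiples of the indicator function of the null set `s`
  have key : ∀ t : ℝ≥0, t * m s ≤ L := by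
    intro t
    have hsq : ∀ ν : Measure (E n),
        ∫⁻ x, ((s.indicator (fun _ => t) x : ℝ≥0) : ℝ≥0∞) ^ 2 ∂ν = t ^ 2 * ν s := by
      intro ν
      rw [← setLIntegral_const, ← lintegral_indicator hs]
      refine lintegral_congr fun x => ?_
      by_cases hx : x ∈ s <;> simp [hx]
    have h1 := two_mul_lintegral_le_of_forall_hasCompactSupport H
      (h := s.indicator fun _ => t) (measurable_const.indicator hs)
      (by rw [hsq, hs0, mul_zero]; simp)
      (by rw [hsq]; exact ENNReal.mul_ne_top (by simp) (measure_ne_top _ _))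
    rw [hsq, hs0, mul_zero, add_zero] at h1
    have h2 : ∫⁻ x, ((s.indicator (fun _ => t) x : ℝ≥0) : ℝ≥0∞) ∂m = t * m s := by
      rw [← setLIntegral_const, ← lintegral_indicator hs]
      refine lintegral_congr fun x => ?_
      by_cases hx : x ∈ s <;> simp [hx]
    rw [h2] at h1
    refine le_trans ?_ h1
    rw [two_mul]
    exact le_self_add
  have := key ((L / m s).toNNReal + 1)
  have hdiv : L / m s ≠ ∞ := (ENNReal.div_lt_top hL hne).ne
  rw [ENNReal.coe_add, ENNReal.coe_toNNReal hdiv, add_mul,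
    ENNReal.div_mul_cancel hne (measure_ne_top _ _), ENNReal.coe_one, one_mul] at this
  exact hne (nonpos_iff_eq_zero.1
    ((ENNReal.add_le_add_iff_left hL).1 (this.trans_eq (add_zero L).symm)))

open NNReal in
theorem lintegral_sq_le_of_two_mul_lintegral_le {f : E n → ℝ≥0∞} (hf : Measurable f)
    [IsFiniteMeasure (volume.withDensity f)] {L : ℝ≥0∞}
    (H : ∀ h : E n → ℝ≥0, Continuous h → HasCompactSupport h →
      2 * ∫⁻ x, h x ∂(volume.withDensity f) ≤ L + ∫⁻ x, (h x : ℝ≥0∞) ^ 2) :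
    ∫⁻ x, f x ^ 2 ≤ L := by
  have hfi : ∫⁻ x, f x ≠ ∞ := by
    have := measure_ne_top (volume.withDensity f) univ
    rwa [withDensity_apply _ MeasurableSet.univ, Measure.restrict_univ] at this
  -- test with the truncations `min f k`, which are square integrable because `f` is integrable
  have key : ∀ k : ℕ, ∫⁻ x, min (f x) k * f x ≤ L := by
    intro k
    have hmin : Measurable fun x => min (f x) (k : ℝ≥0∞) := hf.min measurable_const
    have hcoe : ∀ x, (((min (f x) k).toNNReal : ℝ≥0) : ℝ≥0∞) = min (f x) k := fun x =>
      ENNReal.coe_toNNReal (ne_top_of_le_ne_top (ENNReal.natCast_ne_top k) (min_le_right _ _))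
    have hle : ∫⁻ x, min (f x) k ^ 2 ≤ ∫⁻ x, min (f x) k * f x := lintegral_mono fun x => by
      rw [sq]; exact mul_le_mul' le_rfl (min_le_left _ _)
    have hfin : ∫⁻ x, min (f x) k * f x ≠ ∞ := by
      refine ne_top_of_le_ne_top (ENNReal.mul_ne_top (ENNReal.natCast_ne_top k) hfi) ?_
      rw [← lintegral_const_mul _ hf]
      exact lintegral_mono fun x => mul_le_mul' (min_le_right _ _) le_rfl
    have h1 := two_mul_lintegral_le_of_forall_hasCompactSupport H
      (h := fun x => (min (f x) k).toNNReal) hmin.ennreal_toNNReal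
      (by simp_rw [hcoe]; exact ne_top_of_le_ne_top hfin hle)
      (by
        simp_rw [hcoe]
        refine ne_top_of_le_ne_top ?_ (lintegral_mono (g := fun _ => (k : ℝ≥0∞) ^ 2) fun x => by
          exact pow_le_pow_left' (min_le_right _ _) 2)
        rw [lintegral_const]
        exact ENNReal.mul_ne_top (by simp) (measure_ne_top _ _))
    simp_rw [hcoe] at h1
    rw [lintegral_withDensity_eq_lintegral_mul _ hf hmin] at h1
    simp_rw [Pi.mul_apply, mul_comm (f _)] at h1
    have h2 := h1.trans (add_le_add_right hle L)
    rw [two_mul] at h2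
    exact (ENNReal.add_le_add_iff_right hfin).1 h2
  have hlim : Tendsto (fun k : ℕ => ∫⁻ x, min (f x) k * f x) atTop (𝓝 (∫⁻ x, f x ^ 2)) := by
    refine lintegral_tendsto_of_tendsto_of_monotone
      (fun k => ((hf.min measurable_const).mul hf).aemeasurable)
      (ae_of_all _ fun x i j hij => by dsimp only; gcongr) (ae_of_all _ fun x => ?_)
    have h1 : Tendsto (fun k : ℕ => min (f x) (k : ℝ≥0∞)) atTop (𝓝 (f x)) := by
      have := (tendsto_const_nhds (x := f x)).min ENNReal.tendsto_nat_nhds_top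
      rwa [min_top_right] at this
    rw [sq]
    rcases eq_or_ne (f x) 0 with h0 | h0
    · simp [h0]
    · exact ENNReal.Tendsto.mul h1 (Or.inl h0) tendsto_const_nhds (Or.inl h0)
  exact le_of_tendsto' hlim key

end Duality

/-! ### The weight `p ^ (-1/2)`, the energy and the `χ²`-divergence -/

section Weight

variable {n : ℕ} {X : Set (E n)} {p : E n → ℝ}

open NNReal

/-- `w` is a positive continuous function on `ℝⁿ` that extends `p ^ (-1/2)` from `X`. -/
structure IsWeight (X : Set (E n)) (p : E n → ℝ) (w : E n → ℝ≥0) : Prop where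
  continuous : Continuous w
  pos : ∀ x, 0 < w x
  eq_rpow : ∀ x ∈ X, (w x : ℝ) = p x ^ (-(1 / 2) : ℝ)

theorem IsTargetDensity.exists_isWeight (hX : IsClosed X) (hp : IsTargetDensity X p) :
    ∃ w, IsWeight X p w := by
  have hc : Continuous fun x : X => Real.log (p x) :=
    (continuousOn_iff_continuous_domRestrict.1 hp.contDiffOn.continuousOn).log
      fun x => (hp.pos x x.2).ne'
  obtain ⟨g, hg⟩ := ContinuousMap.exists_restrict_eq hX ⟨fun x : X => Real.log (p x), hc⟩
  refine ⟨fun x => (Real.exp (g x * (-(1 / 2)))).toNNReal, ?_, fun x => ?_, fun x hx => ?_⟩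
  · exact continuous_real_toNNReal.comp (by fun_prop)
  · exact Real.toNNReal_pos.2 (Real.exp_pos _)
  · have : g x = Real.log (p x) := DFunLike.congr_fun hg (⟨x, hx⟩ : X)
    rw [Real.coe_toNNReal _ (Real.exp_pos _).le, this, Real.rpow_def_of_pos (hp.pos x hx)]

variable {w : E n → ℝ≥0}

theorem IsWeight.measurable (hw : IsWeight X p w) : Measurable fun x => (w x : ℝ≥0∞) :=
  hw.continuous.measurable.coe_nnreal_ennreal

theorem IsWeight.ofReal_eq (hw : IsWeight X p w) (hp : IsTargetDensity X p) {x : E n}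
    (hx : x ∈ X) : ENNReal.ofReal (p x) = ((w x : ℝ≥0∞) ^ 2)⁻¹ := by
  have hpx := hp.pos x hx
  rw [← ENNReal.coe_pow, ← ENNReal.coe_inv (pow_ne_zero 2 (hw.pos x).ne'), ENNReal.ofReal,
    ENNReal.coe_inj]
  apply NNReal.eq
  rw [Real.coe_toNNReal _ hpx.le, NNReal.coe_inv, NNReal.coe_pow, hw.eq_rpow x hx,
    ← Real.rpow_natCast, ← Real.rpow_mul hpx.le, ← Real.rpow_neg hpx.le]
  norm_num

theorem weightedKernel_eq (hw : IsWeight X p w) (hp : IsTargetDensity X p) (φ : ℝ → E n → ℝ)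
    (ε : ℝ) {x y : E n} (hx : x ∈ X) (hy : y ∈ X) (h0 : 0 ≤ φ ε (x - y)) :
    weightedKernel X p φ ε x y = ENNReal.ofReal (φ ε (x - y)) * (w x * w y) := by
  rw [weightedKernel, if_pos ⟨hx, hy⟩, ENNReal.ofReal_mul h0,
    Real.mul_rpow (hp.pos x hx).le (hp.pos y hy).le, ← hw.eq_rpow x hx, ← hw.eq_rpow y hy,
    ← NNReal.coe_mul, ENNReal.ofReal_coe_nnreal, ENNReal.coe_mul]

theorem energy_eq_convEnergy (hw : IsWeight X p w) (hp : IsTargetDensity X p)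
    {φ : ℝ → E n → ℝ} {ε : ℝ} (hφ : IsAdmissible X (φ ε)) {μ : ProbabilityMeasure (E n)}
    (hμ : (μ : Measure (E n)) Xᶜ = 0) :
    energy X p φ ε μ = convEnergy (φ ε) ((μ : Measure (E n)).withDensity fun x => w x)
      ((μ : Measure (E n)).withDensity fun x => w x) := by
  have hmeas : Measurable fun z : E n × E n =>
      ENNReal.ofReal (φ ε (z.1 - z.2)) * ((w z.1 : ℝ≥0∞) * w z.2) :=
    hφ.measurable_kernel.ennreal_ofReal.mul
      ((hw.measurable.comp measurable_fst).mul (hw.measurable.comp measurable_snd))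
  rw [convEnergy_withDensity hφ.continuous.measurable hw.measurable hw.measurable,
    lintegral_prod_symm _ hmeas.aemeasurable, energy]
  have hX : ∀ᵐ x ∂(μ : Measure (E n)), x ∈ X := hμ
  refine lintegral_congr_ae ?_
  filter_upwards [hX] with y hy
  refine lintegral_congr_ae ?_
  filter_upwards [hX] with x hx
  exact weightedKernel_eq hw hp φ ε hx hy (hφ.nonneg _)

theorem measure_compl_eq_zero_of_energy_ne_top (hX : MeasurableSet X) {φ : ℝ → E n → ℝ} {ε : ℝ}
    {μ : ProbabilityMeasure (E n)} (h : energy X p φ ε μ ≠ ∞) :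
    (μ : Measure (E n)) Xᶜ = 0 := by
  by_contra hne
  refine h (top_unique ?_)
  calc (∞ : ℝ≥0∞) = ∫⁻ _ in Xᶜ, ∞ ∂(μ : Measure (E n)) := by
        rw [setLIntegral_const, ENNReal.top_mul hne]
    _ ≤ ∫⁻ y in Xᶜ, ∫⁻ x, weightedKernel X p φ ε x y ∂(μ : Measure (E n))
          ∂(μ : Measure (E n)) := by
        refine setLIntegral_mono' hX.compl fun y hy => ?_
        have : ∀ x, weightedKernel X p φ ε x y = ∞ := fun x =>
          if_neg fun h => hy h.2
        simp [this]
    _ ≤ _ := setLIntegral_le_lintegral _ _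

/-- The density of the target measure with respect to Lebesgue measure, written with the weight
`w = p ^ (-1/2)`. -/
noncomputable def targetDensity (X : Set (E n)) (p : E n → ℝ) (w : E n → ℝ≥0) (x : E n) : ℝ≥0∞ :=
  X.indicator (fun x => (mass X p)⁻¹ * ((w x : ℝ≥0∞) ^ 2)⁻¹) x

theorem measurable_targetDensity (hX : MeasurableSet X) (hw : IsWeight X p w) :
    Measurable (targetDensity X p w) :=
  (((hw.measurable.pow_const 2).inv).const_mul _).indicator hX

theorem target_eq_withDensity (hX : MeasurableSet X) (hw : IsWeight X p w)
    (hp : IsTargetDensity X p) :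
    (target hp : Measure (E n)) = volume.withDensity (targetDensity X p w) := by
  have h1 : (target hp : Measure (E n)) =
      (mass X p)⁻¹ • (volume.restrict X).withDensity fun x => ENNReal.ofReal (p x) := rfl
  have h2 : (volume.restrict X).withDensity (fun x => ENNReal.ofReal (p x)) =
      (volume.restrict X).withDensity fun x => ((w x : ℝ≥0∞) ^ 2)⁻¹ :=
    withDensity_congr_ae ((ae_restrict_iff' hX).2
      (ae_of_all _ fun x hx => hw.ofReal_eq hp hx))
  have hi : Measurable fun x => ((w x : ℝ≥0∞) ^ 2)⁻¹ := (hw.measurable.pow_const 2).inv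
  rw [h1, h2, ← withDensity_smul _ hi, ← withDensity_indicator hX]
  rfl

theorem chiSq_add_one {Ω : Type*} [MeasurableSpace Ω] (Q P : ProbabilityMeasure Ω)
    (h : (Q : Measure Ω) ≪ (P : Measure Ω)) :
    chiSq Q P + 1 = ∫⁻ x, (Q : Measure Ω).rnDeriv P x ^ 2 ∂(P : Measure Ω) := by
  set r := (Q : Measure Ω).rnDeriv P with hr
  have hrm : Measurable r := Measure.measurable_rnDeriv _ _
  have h1 : ∫⁻ x, r x ∂(P : Measure Ω) = 1 := by
    rw [Measure.lintegral_rnDeriv h, measure_univ]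
  -- `(r - 1)² = r² - 2 r + 1`, rearranged so that no subtraction in `ℝ≥0∞` occurs
  have hpt : ∀ᵐ x ∂(P : Measure Ω),
      ENNReal.ofReal (((r x).toReal - 1) ^ 2) + 2 * r x = r x ^ 2 + 1 := by
    filter_upwards [Measure.rnDeriv_lt_top (Q : Measure Ω) P] with x hx
    lift r x to ℝ≥0 using hx.ne with t
    rw [ENNReal.coe_toReal, ← ENNReal.ofReal_coe_nnreal (p := t), ← ENNReal.ofReal_ofNat 2,
      ← ENNReal.ofReal_mul (by norm_num), ← ENNReal.ofReal_add (sq_nonneg _) (by positivity),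
      ← ENNReal.ofReal_pow t.coe_nonneg, ← ENNReal.ofReal_one,
      ← ENNReal.ofReal_add (by positivity) one_pos.le]
    congr 1
    ring
  have h2 := lintegral_congr_ae hpt
  rw [lintegral_add_right _ (hrm.const_mul 2), lintegral_const_mul _ hrm, h1,
    lintegral_add_right _ measurable_const, lintegral_const, measure_univ] at h2
  rw [chiSq, if_pos h]
  refine (ENNReal.add_left_inj ENNReal.one_ne_top).1 ?_
  rw [add_assoc, one_add_one_eq_two]
  simpa using h2

/-- For an absolutely continuous `μ = f dx` carried by `X`, the limit energy is the squared
`L²`-norm of `p ^ (-1/2) f`. -/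
theorem chiSq_add_one_div_mass (hX : MeasurableSet X) (hw : IsWeight X p w)
    (hp : IsTargetDensity X p) {μ : ProbabilityMeasure (E n)}
    (hμ : (μ : Measure (E n)) ≪ (target hp : Measure (E n))) {f : E n → ℝ≥0∞} (hf : Measurable f)
    (hμf : (μ : Measure (E n)) = volume.withDensity f) :
    (chiSq μ (target hp) + 1) / mass X p = ∫⁻ x, (f x * w x) ^ 2 := by
  set r := (μ : Measure (E n)).rnDeriv (target hp : Measure (E n)) with hr
  have hrm : Measurable r := Measure.measurable_rnDeriv _ _
  have hτ := measurable_targetDensity (p := p) hX hw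
  have h1 : (μ : Measure (E n)) = volume.withDensity (targetDensity X p w * r) := by
    have : (μ : Measure (E n)).HaveLebesgueDecomposition (target hp : Measure (E n)) :=
      Measure.haveLebesgueDecomposition_of_sigmaFinite _ _
    rw [withDensity_mul _ hτ hrm, ← target_eq_withDensity hX hw hp, hr,
      Measure.withDensity_rnDeriv_eq _ _ hμ]
  have hfi : ∫⁻ x, f x ≠ ∞ := by
    have := measure_ne_top (μ : Measure (E n)) univ
    rwa [hμf, withDensity_apply _ MeasurableSet.univ, Measure.restrict_univ] at this
  have h2 : f =ᵐ[volume] targetDensity X p w * r :=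
    (withDensity_eq_iff hf.aemeasurable (hτ.mul hrm).aemeasurable hfi).1 (hμf.symm.trans h1)
  have hZ : (mass X p)⁻¹ ≠ ∞ := ENNReal.inv_ne_top.2 hp.mass_pos.ne'
  rw [chiSq_add_one _ _ hμ, ENNReal.div_eq_inv_mul]
  rw [← hr]
  conv_lhs => rw [target_eq_withDensity hX hw hp]
  rw [lintegral_withDensity_eq_lintegral_mul _ hτ (hrm.pow_const 2),
    ← lintegral_const_mul' _ _ hZ]
  refine lintegral_congr_ae ?_
  filter_upwards [h2] with x hx
  rw [hx, Pi.mul_apply, Pi.mul_apply, targetDensity]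
  by_cases hxX : x ∈ X
  · have hw0 : (w x : ℝ≥0∞) ^ 2 ≠ 0 := by simpa using (hw.pos x).ne'
    rw [indicator_of_mem hxX]
    calc (mass X p)⁻¹ * ((mass X p)⁻¹ * ((w x : ℝ≥0∞) ^ 2)⁻¹ * r x ^ 2)
        = (mass X p)⁻¹ ^ 2 * r x ^ 2 * ((w x : ℝ≥0∞) ^ 2)⁻¹ * 1 := by ring
      _ = (mass X p)⁻¹ ^ 2 * r x ^ 2 * ((w x : ℝ≥0∞) ^ 2)⁻¹ *
            (((w x : ℝ≥0∞) ^ 2)⁻¹ * (w x : ℝ≥0∞) ^ 2) := by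
          rw [ENNReal.inv_mul_cancel hw0 (by simp)]
      _ = _ := by ring
  · simp [indicator_of_notMem hxX]

theorem absolutelyContinuous_target (hX : MeasurableSet X) (hw : IsWeight X p w)
    (hp : IsTargetDensity X p) {μ : Measure (E n)} (hμX : μ Xᶜ = 0) (hμ : μ ≪ volume) :
    μ ≪ (target hp : Measure (E n)) := by
  intro s hs
  rw [target_eq_withDensity hX hw hp,
    withDensity_apply_eq_zero (measurable_targetDensity hX hw)] at hs
  have h1 := hμ hs
  refine measure_mono_null (t := _ ∪ Xᶜ) (fun x hx => ?_) (measure_union_null h1 hμX)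
  by_cases hxX : x ∈ X
  · refine Or.inl ⟨?_, hx⟩
    change targetDensity X p w x ≠ 0
    rw [targetDensity, indicator_of_mem hxX]
    exact mul_ne_zero (ENNReal.inv_ne_zero.2 hp.mass_lt_top.ne)
      (ENNReal.inv_ne_zero.2 (ENNReal.pow_ne_top ENNReal.coe_ne_top))
  · exact Or.inr hxX

theorem target_absolutelyContinuous (hX : MeasurableSet X) (hw : IsWeight X p w)
    (hp : IsTargetDensity X p) : (target hp : Measure (E n)) ≪ volume := by
  rw [target_eq_withDensity hX hw hp]
  exact withDensity_absolutelyContinuous _ _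

theorem target_compl (hX : MeasurableSet X) (hp : IsTargetDensity X p) :
    (target hp : Measure (E n)) Xᶜ = 0 := by
  have h1 : (target hp : Measure (E n)) =
      (mass X p)⁻¹ • (volume.restrict X).withDensity fun x => ENNReal.ofReal (p x) := rfl
  have h2 : (volume.restrict X).withDensity (fun x => ENNReal.ofReal (p x)) Xᶜ = 0 :=
    withDensity_absolutelyContinuous _ _ (by rw [Measure.restrict_apply hX.compl]; simp)
  rw [h1, Measure.smul_apply, h2, smul_zero]

end Weight

/-! ### `Γ`-convergence -/

section Gamma

variable {n : ℕ} {X : Set (E n)} {p : E n → ℝ} {φ : ℝ → E n → ℝ}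

open NNReal BoundedContinuousFunction

/-- A sublevel form of the `Γ`-liminf inequality, along an arbitrary filter. -/
theorem chiSq_le_of_frequently_energy_le (hX : IsClosed X) (hXvol : 0 < volume X)
    (hp : IsTargetDensity X p) (hφ : IsMollifierFamily φ)
    (hadm : ∀ ε > 0, IsAdmissible X (φ ε)) {l : Filter ℝ} (hl : l ≤ 𝓝[>] 0)
    {μ : ℝ → ProbabilityMeasure (E n)} {μ₀ : ProbabilityMeasure (E n)}
    (hμ : Tendsto μ l (𝓝 μ₀)) {L : ℝ≥0∞} (hLtop : L ≠ ∞)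
    (hL : ∃ᶠ ε in l, energy X p φ ε (μ ε) ≤ L) :
    (chiSq μ₀ (target hp) + 1) / mass X p ≤ L := by
  obtain ⟨w, hw⟩ := hp.exists_isWeight hX
  have hXm := hX.measurableSet
  have hL' : ∃ᶠ ε in l, 0 < ε ∧ (μ ε : Measure (E n)) Xᶜ = 0 ∧ energy X p φ ε (μ ε) ≤ L := by
    have hpos : ∀ᶠ ε in l, 0 < ε := hl self_mem_nhdsWithin
    exact (hL.and_eventually hpos).mono fun ε h =>
      ⟨h.2, measure_compl_eq_zero_of_energy_ne_top hXm (ne_top_of_le_ne_top hLtop h.1), h.1⟩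
  have hμX : (μ₀ : Measure (E n)) Xᶜ = 0 := by
    refine nonpos_iff_eq_zero.1 ((ProbabilityMeasure.le_liminf_measure_open_of_tendsto hμ
      hX.isOpen_compl).trans ?_)
    exact liminf_le_of_frequently_le (hL'.mono fun ε h => h.2.1.le)
  -- bounded continuous functions increasing to the weight, which may be unbounded on `X`
  let ψ : ℕ → (E n →ᵇ ℝ≥0) := fun k => mkOfBound
    ⟨fun x => min (w x) (k + 1), hw.continuous.min continuous_const⟩ (k + 1) fun x y => by
      have h1 : ((min (w x) (k + 1) : ℝ≥0) : ℝ) ≤ k + 1 := by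
        exact_mod_cast (min_le_right (w x) ((k : ℝ≥0) + 1))
      have h2 : ((min (w y) (k + 1) : ℝ≥0) : ℝ) ≤ k + 1 := by
        exact_mod_cast (min_le_right (w y) ((k : ℝ≥0) + 1))
      have h3 := (min (w x) ((k : ℝ≥0) + 1)).coe_nonneg
      have h4 := (min (w y) ((k : ℝ≥0) + 1)).coe_nonneg
      rw [NNReal.dist_eq, abs_le]
      constructor <;> dsimp only [ContinuousMap.coe_mk] <;> linarith
  have hψ : ∀ k x, ψ k x = min (w x) (k + 1) := fun k x => rfl
  have hψm : ∀ k, Measurable fun x => (ψ k x : ℝ≥0∞) := fun k =>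
    (ψ k).continuous.measurable.coe_nnreal_ennreal
  have hfin : ∀ k, IsFiniteMeasure ((μ₀ : Measure (E n)).withDensity fun x => (ψ k x : ℝ≥0∞)) :=
    fun k => isFiniteMeasure_withDensity ((ψ k).lintegral_lt_top_of_nnreal _).ne
  have test : ∀ k, ∀ h : E n → ℝ≥0, Continuous h → HasCompactSupport h →
      2 * ∫⁻ x, h x ∂((μ₀ : Measure (E n)).withDensity fun x => (ψ k x : ℝ≥0∞)) ≤
        L + ∫⁻ x, (h x : ℝ≥0∞) ^ 2 := by
    intro k h hh hhc
    rw [lintegral_withDensity_eq_lintegral_mul _ (hψm k) hh.measurable.coe_nnreal_ennreal]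
    refine two_mul_lintegral_le_of_tendsto hX hXvol hφ hadm hl hμ (ψ k)
      (hL'.mono fun ε hε => ?_) hh hhc
    refine le_trans ?_ hε.2.2
    have ha := hadm ε hε.1
    rw [energy_eq_convEnergy hw hp ha hε.2.1,
      convEnergy_withDensity ha.continuous.measurable (hψm k) (hψm k),
      convEnergy_withDensity ha.continuous.measurable hw.measurable hw.measurable]
    have hle : ∀ x, (ψ k x : ℝ≥0∞) ≤ w x := fun x => by
      rw [hψ, ENNReal.coe_le_coe]; exact min_le_left _ _
    exact lintegral_mono fun z => mul_le_mul' le_rfl (mul_le_mul' (hle _) (hle _))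
  have hac : (μ₀ : Measure (E n)) ≪ volume := by
    have := hfin 0
    refine (withDensity_absolutelyContinuous' (hψm 0).aemeasurable (ae_of_all _ fun x => ?_)).trans
      (absolutelyContinuous_of_two_mul_lintegral_le hLtop (test 0))
    rw [hψ, ENNReal.coe_ne_zero]
    exact (lt_min (hw.pos x) (by positivity)).ne'
  set f := (μ₀ : Measure (E n)).rnDeriv volume with hf
  have hfm : Measurable f := Measure.measurable_rnDeriv _ _
  have hμf : (μ₀ : Measure (E n)) = volume.withDensity f :=
    (Measure.withDensity_rnDeriv_eq _ _ hac).symm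
  have key : ∀ k, ∫⁻ x, (f x * ψ k x) ^ 2 ≤ L := by
    intro k
    have e : (μ₀ : Measure (E n)).withDensity (fun x => (ψ k x : ℝ≥0∞)) =
        volume.withDensity fun x => f x * ψ k x := by
      conv_lhs => rw [hμf]
      exact (withDensity_mul _ hfm (hψm k)).symm
    have h1 := hfin k
    have h2 := test k
    rw [e] at h1 h2
    exact lintegral_sq_le_of_two_mul_lintegral_le (hfm.mul (hψm k)) h2
  have hlim : Tendsto (fun k => ∫⁻ x, (f x * ψ k x) ^ 2) atTop
      (𝓝 (∫⁻ x, (f x * w x) ^ 2)) := by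
    refine lintegral_tendsto_of_tendsto_of_monotone
      (fun k => ((hfm.mul (hψm k)).pow_const 2).aemeasurable)
      (ae_of_all _ fun x i j hij => ?_) (ae_of_all _ fun x => ?_)
    · have : ψ i x ≤ ψ j x := by
        rw [hψ, hψ]
        gcongr
      dsimp only
      gcongr
    · refine tendsto_const_nhds.congr' ?_
      obtain ⟨K, hK⟩ := exists_nat_ge (w x)
      filter_upwards [eventually_ge_atTop K] with k hk
      rw [hψ, min_eq_left (hK.trans ((Nat.cast_le.2 hk).trans (by simp)))]
  rw [chiSq_add_one_div_mass hXm hw hp (absolutelyContinuous_target hXm hw hp hμX hac) hfm hμf]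
  exact le_of_tendsto' hlim key

/-- The mollified energy is bounded by the limit energy, so that constant families are recovery
families. -/
theorem energy_le (hX : IsClosed X) (hp : IsTargetDensity X p) (hφ : IsMollifierFamily φ)
    (hadm : ∀ ε > 0, IsAdmissible X (φ ε)) {ε : ℝ} (hε : 0 < ε)
    (μ : ProbabilityMeasure (E n)) :
    energy X p φ ε μ ≤ (chiSq μ (target hp) + 1) / mass X p := by
  obtain ⟨w, hw⟩ := hp.exists_isWeight hX
  have hXm := hX.measurableSet
  by_cases hμ : (μ : Measure (E n)) ≪ (target hp : Measure (E n))
  · have hac := hμ.trans (target_absolutelyContinuous hXm hw hp)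
    set f := (μ : Measure (E n)).rnDeriv volume with hf
    have hfm : Measurable f := Measure.measurable_rnDeriv _ _
    have hμf : (μ : Measure (E n)) = volume.withDensity f :=
      (Measure.withDensity_rnDeriv_eq _ _ hac).symm
    rw [chiSq_add_one_div_mass hXm hw hp hμ hfm hμf,
      energy_eq_convEnergy hw hp (hadm ε hε) (hμ (target_compl hXm hp))]
    have e : (μ : Measure (E n)).withDensity (fun x => (w x : ℝ≥0∞)) =
        volume.withDensity fun x => f x * w x := by
      conv_lhs => rw [hμf]
      exact (withDensity_mul _ hfm hw.measurable).symm
    rw [e]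
    exact hφ.convEnergy_withDensity_le hε (hfm.mul hw.measurable)
  · rw [chiSq, if_neg hμ, top_add, ENNReal.top_div_of_ne_top hp.mass_lt_top.ne]
    exact le_top

theorem gammaConverges_energy (hX : IsClosed X) (hXvol : 0 < volume X)
    (hp : IsTargetDensity X p) (hφ : IsMollifierFamily φ)
    (hadm : ∀ ε > 0, IsAdmissible X (φ ε)) :
    GammaConverges (energy X p φ) fun μ => (chiSq μ (target hp) + 1) / mass X p where
  liminf_ge μ μ₀ hμ := by
    refine le_of_forall_gt_imp_ge_of_dense fun L hL => ?_
    rcases eq_or_ne L ∞ with rfl | hLtop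
    · exact le_top
    · exact chiSq_le_of_frequently_energy_le hX hXvol hp hφ hadm le_rfl hμ hLtop
        ((frequently_lt_of_liminf_lt (by isBoundedDefault) hL).mono fun _ h => h.le)
  limsup_le μ₀ := by
    refine ⟨fun _ => μ₀, tendsto_const_nhds, limsup_le_of_le (by isBoundedDefault) ?_⟩
    filter_upwards [self_mem_nhdsWithin] with ε hε
    exact energy_le hX hp hφ hadm hε μ₀

end Gamma

/-! ### Minimizers on a compact set -/

section Minimizers

variable {n : ℕ} {X : Set (E n)} {p : E n → ℝ} {φ : ℝ → E n → ℝ}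

open NNReal BoundedContinuousFunction

theorem mem_probOn_iff (hX : MeasurableSet X) {μ : ProbabilityMeasure (E n)} :
    μ ∈ probOn X ↔ (μ : Measure (E n)) Xᶜ = 0 := (prob_compl_eq_zero_iff hX).symm

theorem isCompact_probOn (hX : IsCompact X) : IsCompact (probOn X) := by
  have h := isCompact_setOfPred_probabilityMeasure_mass_eq_compl_isCompact_le (E := E n)
    (u := fun _ => 0) (K := fun _ => X) tendsto_const_nhds (fun _ => hX) (Or.inr monotone_const)
  convert h using 1
  ext μ
  rw [mem_probOn_iff hX.measurableSet]
  simp only [mem_ofPred_eq, forall_const, nonpos_iff_eq_zero]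
  exact (ProbabilityMeasure.null_iff_toMeasure_null μ Xᶜ).symm

theorem target_mem_probOn (hX : MeasurableSet X) (hp : IsTargetDensity X p) :
    target hp ∈ probOn X := (mem_probOn_iff hX).2 (target_compl hX hp)

theorem IsTargetDensity.exists_isWeight_le (hX : IsCompact X) (hp : IsTargetDensity X p) :
    ∃ w, IsWeight X p w ∧ ∃ C, ∀ x, w x ≤ C := by
  obtain ⟨w, hw⟩ := hp.exists_isWeight hX.isClosed
  obtain ⟨C, hC⟩ := (hX.image hw.continuous).bddAbove
  have hC' : ∀ x ∈ X, w x ≤ C + 1 := fun x hx =>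
    (hC (mem_image_of_mem _ hx)).trans (by simp)
  refine ⟨fun x => min (w x) (C + 1), ⟨hw.continuous.min continuous_const,
    fun x => lt_min (hw.pos x) (by positivity), fun x hx => ?_⟩, C + 1, fun x => min_le_right _ _⟩
  rw [min_eq_left (hC' x hx), hw.eq_rpow x hx]

theorem continuousOn_energy (hX : IsCompact X) (hp : IsTargetDensity X p) {ε : ℝ}
    (hφ : IsAdmissible X (φ ε)) : ContinuousOn (energy X p φ ε) (probOn X) := by
  obtain ⟨w, hw, C, hC⟩ := hp.exists_isWeight_le hX
  obtain ⟨M, hM⟩ := hφ.bddAbove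
  have hM' : ∀ x, (φ ε x).toNNReal ≤ M.toNNReal := fun x =>
    Real.toNNReal_le_toNNReal (hM (mem_range_self x))
  let F : (E n × E n) →ᵇ ℝ≥0 := mkOfBound
    ⟨fun z => (φ ε (z.1 - z.2)).toNNReal * (w z.1 * w z.2),
      (continuous_real_toNNReal.comp (hφ.continuous.comp (continuous_fst.sub continuous_snd))).mul
        ((hw.continuous.comp continuous_fst).mul (hw.continuous.comp continuous_snd))⟩
    (M.toNNReal * (C * C) : ℝ≥0) fun x y => by
      have hb : ∀ z : E n × E n, (φ ε (z.1 - z.2)).toNNReal * (w z.1 * w z.2) ≤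
          M.toNNReal * (C * C) := fun z =>
        mul_le_mul' (hM' _) (mul_le_mul' (hC _) (hC _))
      have h1 := NNReal.coe_le_coe.2 (hb x)
      have h2 := NNReal.coe_le_coe.2 (hb y)
      have h3 := ((φ ε (x.1 - x.2)).toNNReal * (w x.1 * w x.2)).coe_nonneg
      have h4 := ((φ ε (y.1 - y.2)).toNNReal * (w y.1 * w y.2)).coe_nonneg
      rw [NNReal.dist_eq, abs_le]
      constructor <;> dsimp only [ContinuousMap.coe_mk] <;> linarith
  have hF : Continuous fun μ : ProbabilityMeasure (E n) =>
      ∫⁻ z, F z ∂((μ.prod μ : ProbabilityMeasure (E n × E n)) : Measure (E n × E n)) := by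
    rw [continuous_iff_continuousAt]
    intro μ
    have h : Tendsto (fun ν : ProbabilityMeasure (E n) => ν.prod ν) (𝓝 μ) (𝓝 (μ.prod μ)) :=
      (ProbabilityMeasure.continuous_prod.comp (continuous_id.prodMk continuous_id)).tendsto μ
    exact ProbabilityMeasure.tendsto_iff_forall_lintegral_tendsto.1 h F
  refine hF.continuousOn.congr fun μ hμ => ?_
  rw [energy_eq_convEnergy hw hp hφ ((mem_probOn_iff hX.measurableSet).1 hμ),
    convEnergy_withDensity hφ.continuous.measurable hw.measurable hw.measurable]
  refine lintegral_congr fun z => ?_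
  rw [ENNReal.ofReal, ← ENNReal.coe_mul, ← ENNReal.coe_mul]
  rfl

theorem exists_isMinimizer (hX : IsCompact X) (hp : IsTargetDensity X p) {ε : ℝ}
    (hφ : IsAdmissible X (φ ε)) : ∃ μ, IsMinimizer X p φ ε μ := by
  obtain ⟨μ, hμ, hmin⟩ := (continuousOn_energy hX hp hφ).lowerSemicontinuousOn.exists_isMinOn
    ⟨_, target_mem_probOn hX.measurableSet hp⟩ (isCompact_probOn hX)
  exact ⟨μ, hμ, fun ν hν => hmin hν⟩

/-- The equally weighted mixture of two probability measures. -/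
noncomputable def mixture {Ω : Type*} [MeasurableSpace Ω] (μ ν : ProbabilityMeasure Ω) :
    ProbabilityMeasure Ω :=
  ⟨(2⁻¹ : ℝ≥0∞) • ((μ : Measure Ω) + (ν : Measure Ω)), ⟨by
    rw [Measure.smul_apply, Measure.add_apply, measure_univ, measure_univ, smul_eq_mul,
      one_add_one_eq_two]
    exact ENNReal.inv_mul_cancel (by simp) (by simp)⟩⟩

theorem mutualEnergy_smul_smul {Y : Type*} [MeasurableSpace Y] (K : Y → Y → ℝ) (c : ℝ≥0∞)
    (m₁ m₂ : Measure Y) [SFinite m₁] [SFinite m₂] :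
    mutualEnergy K (c • m₁) (c • m₂) = c * (c * mutualEnergy K m₁ m₂) := by
  rw [mutualEnergy, Measure.prod_smul_left, Measure.prod_smul_right, lintegral_smul_measure,
    lintegral_smul_measure]
  rfl

/-- Uniqueness: if the energy of the mixture is not below the common minimum, then the weighted
difference of the two minimizers has energy zero. -/
theorem IsMinimizer.unique (hX : IsCompact X) (hp : IsTargetDensity X p) {ε : ℝ}
    (hφ : IsAdmissible X (φ ε)) {μ ν : ProbabilityMeasure (E n)} (hμ : IsMinimizer X p φ ε μ)
    (hν : IsMinimizer X p φ ε ν) : μ = ν := by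
  obtain ⟨w, hw, C, hC⟩ := hp.exists_isWeight_le hX
  obtain ⟨M, hM⟩ := hφ.bddAbove
  have hXm := hX.measurableSet
  set a := (μ : Measure (E n)).withDensity fun x => (w x : ℝ≥0∞) with ha
  set b := (ν : Measure (E n)).withDensity fun x => (w x : ℝ≥0∞) with hb
  have hfin : ∀ μ : ProbabilityMeasure (E n),
      IsFiniteMeasure ((μ : Measure (E n)).withDensity fun x => (w x : ℝ≥0∞)) := fun μ => by
    refine isFiniteMeasure_withDensity (ne_top_of_le_ne_top (b := (C : ℝ≥0∞)) (by simp) ?_)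
    refine (lintegral_mono (g := fun _ => (C : ℝ≥0∞)) fun x =>
      ENNReal.coe_le_coe.2 (hC x)).trans ?_
    simp
  have := hfin μ
  have := hfin ν
  have hμX := (mem_probOn_iff hXm).1 hμ.1
  have hνX := (mem_probOn_iff hXm).1 hν.1
  have hmixX : (mixture μ ν : Measure (E n)) Xᶜ = 0 := by
    change ((2⁻¹ : ℝ≥0∞) • ((μ : Measure (E n)) + (ν : Measure (E n)))) Xᶜ = 0
    simp [hμX, hνX]
  have ea : energy X p φ ε μ = convEnergy (φ ε) a a := energy_eq_convEnergy hw hp hφ hμX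
  have eb : energy X p φ ε ν = convEnergy (φ ε) b b := energy_eq_convEnergy hw hp hφ hνX
  have eab : convEnergy (φ ε) a a = convEnergy (φ ε) b b := by
    rw [← ea, ← eb]
    exact le_antisymm (hμ.2 ν hν.1) (hν.2 μ hμ.1)
  have hcomm : convEnergy (φ ε) b a = convEnergy (φ ε) a b :=
    mutualEnergy_comm hφ.measurable_kernel (fun x y => by rw [← neg_sub, hφ.even]) b a
  have emix : energy X p φ ε (mixture μ ν) = 2⁻¹ * (2⁻¹ *
      (2 * convEnergy (φ ε) a a + 2 * convEnergy (φ ε) a b)) := by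
    have e : (mixture μ ν : Measure (E n)).withDensity (fun x => (w x : ℝ≥0∞)) =
        (2⁻¹ : ℝ≥0∞) • (a + b) := by
      change ((2⁻¹ : ℝ≥0∞) • ((μ : Measure (E n)) + (ν : Measure (E n)))).withDensity _ = _
      rw [withDensity_smul_measure, withDensity_add_measure]
    have hab : convEnergy (φ ε) (a + b) (a + b) =
        2 * convEnergy (φ ε) a a + 2 * convEnergy (φ ε) a b := by
      have hcomm' : ∀ m : Measure (E n), IsFiniteMeasure m →
          convEnergy (φ ε) m (a + b) = convEnergy (φ ε) (a + b) m := fun m _ =>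
        mutualEnergy_comm hφ.measurable_kernel (fun x y => by rw [← neg_sub, hφ.even]) _ _
      rw [convEnergy, mutualEnergy_add_left, ← convEnergy, ← convEnergy, hcomm' a inferInstance,
        hcomm' b inferInstance, convEnergy, convEnergy, mutualEnergy_add_left,
        mutualEnergy_add_left, ← convEnergy, ← convEnergy, ← convEnergy, ← convEnergy, hcomm, ← eab]
      ring
    rw [energy_eq_convEnergy hw hp hφ hmixX, e, convEnergy, mutualEnergy_smul_smul,
      ← convEnergy, hab]
  have hle := hμ.2 (mixture μ ν) ((mem_probOn_iff hXm).2 hmixX)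
  have hfa : convEnergy (φ ε) a a ≠ ∞ :=
    mutualEnergy_ne_top (fun _ _ => hM (mem_range_self _)) a a
  -- comparing the energy of the mixture with the minimum
  have hAB : convEnergy (φ ε) a a ≤ convEnergy (φ ε) a b := by
    rw [emix, ea, ← mul_add, ← mul_assoc (2⁻¹ : ℝ≥0∞) 2,
      ENNReal.inv_mul_cancel (by simp) (by simp), one_mul] at hle
    have h2 := mul_le_mul_right hle (2 : ℝ≥0∞)
    rw [← mul_assoc, ENNReal.mul_inv_cancel (by simp) (by simp), one_mul, two_mul] at h2
    exact (ENNReal.add_le_add_iff_left hfa).1 h2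
  have hab : a = b := by
    refine hφ.eq_of_convEnergy_le hXm a b ?_ ?_ ?_
    · exact withDensity_absolutelyContinuous _ _ hμX
    · exact withDensity_absolutelyContinuous _ _ hνX
    · rw [← eab, ← two_mul]
      gcongr
  have hinv : ∀ m : Measure (E n),
      (m.withDensity fun x => (w x : ℝ≥0∞)).withDensity (fun x => (w x : ℝ≥0∞))⁻¹ = m := fun m =>
    withDensity_inv_same hw.measurable
      (ae_of_all _ fun x => ENNReal.coe_ne_zero.2 (hw.pos x).ne')
      (ae_of_all _ fun x => ENNReal.coe_ne_top)
  apply Subtype.ext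
  change (μ : Measure (E n)) = (ν : Measure (E n))
  rw [← hinv μ, ← hinv ν, ← ha, ← hb, hab]

theorem chiSq_self {Ω : Type*} [MeasurableSpace Ω] (P : ProbabilityMeasure Ω) : chiSq P P = 0 := by
  rw [chiSq, if_pos Measure.AbsolutelyContinuous.rfl]
  refine lintegral_eq_zero_of_ae_eq_zero ?_
  filter_upwards [Measure.rnDeriv_self (P : Measure Ω)] with x hx
  rw [hx]
  simp

theorem eq_of_chiSq_eq_zero {Ω : Type*} [MeasurableSpace Ω] {Q P : ProbabilityMeasure Ω}
    (h : chiSq Q P = 0) : Q = P := by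
  by_cases hQP : (Q : Measure Ω) ≪ (P : Measure Ω)
  · rw [chiSq, if_pos hQP, lintegral_eq_zero_iff (by
      exact (((Measure.measurable_rnDeriv _ _).ennreal_toReal.sub_const 1).pow_const
        2).ennreal_ofReal)] at h
    have h1 : (Q : Measure Ω).rnDeriv P =ᵐ[(P : Measure Ω)] 1 := by
      filter_upwards [h, Measure.rnDeriv_ne_top (Q : Measure Ω) P] with x hx hx'
      rw [Pi.zero_apply, ENNReal.ofReal_eq_zero] at hx
      have h2 : ((Q : Measure Ω).rnDeriv P x).toReal - 1 = 0 :=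
        pow_eq_zero_iff two_ne_zero |>.1 (le_antisymm hx (sq_nonneg _))
      rw [← ENNReal.ofReal_toReal hx', sub_eq_zero.1 h2, ENNReal.ofReal_one, Pi.one_apply]
    apply Subtype.ext
    change (Q : Measure Ω) = (P : Measure Ω)
    rw [← Measure.withDensity_rnDeriv_eq _ _ hQP, withDensity_congr_ae h1, withDensity_one]
  · rw [chiSq, if_neg hQP] at h
    exact absurd h ENNReal.top_ne_zero

theorem energy_le_of_isMinimizer (hX : IsCompact X) (hp : IsTargetDensity X p)
    (hφ : IsMollifierFamily φ) (hadm : ∀ ε > 0, IsAdmissible X (φ ε)) {ε : ℝ} (hε : 0 < ε)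
    {μ : ProbabilityMeasure (E n)} (hμ : IsMinimizer X p φ ε μ) :
    energy X p φ ε μ ≤ 1 / mass X p := by
  refine (hμ.2 _ (target_mem_probOn hX.measurableSet hp)).trans ?_
  refine (energy_le hX.isClosed hp hφ hadm hε _).trans ?_
  rw [chiSq_self, zero_add]

theorem tendsto_of_isMinimizer (hX : IsCompact X) (hXvol : 0 < volume X)
    (hp : IsTargetDensity X p) (hφ : IsMollifierFamily φ) (hadm : ∀ ε > 0, IsAdmissible X (φ ε))
    {μ : ℝ → ProbabilityMeasure (E n)} (hμ : ∀ ε > 0, IsMinimizer X p φ ε (μ ε)) :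
    Tendsto μ (𝓝[>] 0) (𝓝 (target hp)) := by
  have hZ : 1 / mass X p ≠ ∞ := (ENNReal.div_lt_top ENNReal.one_ne_top hp.mass_pos.ne').ne
  rw [tendsto_iff_ultrafilter]
  intro g hg
  have hpos : ∀ᶠ ε in (g : Filter ℝ), 0 < ε := hg self_mem_nhdsWithin
  obtain ⟨ν, -, hν⟩ := (isCompact_probOn hX).ultrafilter_le_nhds (g.map μ)
    (le_principal_iff.2 (hpos.mono fun ε hε => (hμ ε hε).1))
  have h := chiSq_le_of_frequently_energy_le hX.isClosed hXvol hp hφ hadm hg hν hZ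
    (hpos.mono fun ε hε => energy_le_of_isMinimizer hX hp hφ hadm hε (hμ ε hε)).frequently
  have h1 : chiSq ν (target hp) + 1 ≤ 1 := by
    rw [ENNReal.div_le_iff hp.mass_pos.ne' hp.mass_lt_top.ne,
      ENNReal.div_mul_cancel hp.mass_pos.ne' hp.mass_lt_top.ne] at h
    exact h
  have h2 : chiSq ν (target hp) = 0 := nonpos_iff_eq_zero.1
    ((ENNReal.add_le_add_iff_right ENNReal.one_ne_top).1 (h1.trans_eq (zero_add 1).symm))
  rw [← eq_of_chiSq_eq_zero h2]
  exact hν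

theorem tendsto_energy_of_isMinimizer (hX : IsCompact X) (hXvol : 0 < volume X)
    (hp : IsTargetDensity X p) (hφ : IsMollifierFamily φ) (hadm : ∀ ε > 0, IsAdmissible X (φ ε))
    {μ : ℝ → ProbabilityMeasure (E n)} (hμ : ∀ ε > 0, IsMinimizer X p φ ε (μ ε)) :
    Tendsto (fun ε => energy X p φ ε (μ ε)) (𝓝[>] 0) (𝓝 (1 / mass X p)) := by
  refine tendsto_of_le_liminf_of_limsup_le ?_ ?_
  · have := (gammaConverges_energy hX.isClosed hXvol hp hφ hadm).liminf_ge μ (target hp)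
      (tendsto_of_isMinimizer hX hXvol hp hφ hadm hμ)
    rwa [chiSq_self, zero_add] at this
  · refine limsup_le_of_le (by isBoundedDefault) ?_
    filter_upwards [self_mem_nhdsWithin] with ε hε
    exact energy_le_of_isMinimizer hX hp hφ hadm hε (hμ ε hε)

end Minimizers

end MollifiedEnergy

theorem theorem2 {n : ℕ} (X : Set (MollifiedEnergy.E n)) (hXclosed : IsClosed X)
    (hXvol : 0 < volume X) (p : MollifiedEnergy.E n → ℝ)
    (hp : MollifiedEnergy.IsTargetDensity X p)
    (φ : ℝ → MollifiedEnergy.E n → ℝ) (hφ : MollifiedEnergy.IsMollifierFamily φ)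
    (hispd : ∀ ε > 0, MollifiedEnergy.IsISPD
      (fun x y : X => φ ε ((x : MollifiedEnergy.E n) - (y : MollifiedEnergy.E n)))) :
    MollifiedEnergy.GammaConverges (MollifiedEnergy.energy X p φ)
      (fun μ => (MollifiedEnergy.chiSq μ (MollifiedEnergy.target hp) + 1) /
        MollifiedEnergy.mass X p) ∧
    (IsCompact X →
      (∀ ε > 0, ∃! μ, MollifiedEnergy.IsMinimizer X p φ ε μ) ∧
      ∀ μs : ℝ → ProbabilityMeasure (MollifiedEnergy.E n),
        (∀ ε > 0, MollifiedEnergy.IsMinimizer X p φ ε (μs ε)) →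
        Tendsto μs (𝓝[>] 0) (𝓝 (MollifiedEnergy.target hp)) ∧
        Tendsto (fun ε => MollifiedEnergy.energy X p φ ε (μs ε)) (𝓝[>] 0)
          (𝓝 (1 / MollifiedEnergy.mass X p))) := by
  have hadm : ∀ ε > 0, MollifiedEnergy.IsAdmissible X (φ ε) := fun ε hε =>
    ⟨(hφ.contDiff ε hε).continuous, hφ.nonneg ε hε, hφ.even ε hε,
      hφ.bddAbove ε hε, hispd ε hε⟩
  refine ⟨MollifiedEnergy.gammaConverges_energy hXclosed hXvol hp hφ hadm, fun hX =>
    ⟨fun ε hε => ?_, fun μs hμs =>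
      ⟨MollifiedEnergy.tendsto_of_isMinimizer hX hXvol hp hφ hadm hμs,
        MollifiedEnergy.tendsto_energy_of_isMinimizer hX hXvol hp hφ hadm hμs⟩⟩⟩
  obtain ⟨μ, hμ⟩ := MollifiedEnergy.exists_isMinimizer hX hp (hadm ε hε)
  exact ⟨μ, hμ, fun ν hν => hν.unique hX hp (hadm ε hε) hμ⟩
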